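/- For an angle $\theta$ write $u_\theta(x,y)=\cos\theta\,x+\sin\theta\,y$ and $v_\theta(x,y)=-\sin\theta\,x+\cos\theta\,y$ for the coordinates in the frame rotated by $\theta$. A polynomial half plane is a set $\{p\in\mathbb R^2 : f(u_\theta(p))-v_\theta(p)\ge 0\}$ with $f$ a real polynomial; the frame rotated by $\theta$ is called its own coordinate frame, and $\{v_\theta=f(u_\theta)\}$ its graph. A region of type I is a simply connected set $X\subseteq\mathbb R^2$ that is the intersection of finitely many polynomial half planes $H_1,\dots,H_k$, given by angles $\theta_i$ and polynomials $f_i$. A shortest-length curve from $A$ to $B$ in $X$ is a piecewise $C^2$ curve $\gamma:[a,b]\to X$, $a<b$, from $A$ to $B$ whose length is least among all piecewise $C^2$ curves from $A$ to $B$ in $X$. Corollary 3.5. Let $X$ be a region of type I and let $\gamma:[a,b]\to X$ be a shortest-length curve between two points of $X$. Then there are $m\ge 0$ and times $$a=s_0\le e_0<s_1\le e_1<\dots<s_m\le e_m=b$$ such that 1. for $0\le j\le m$, $\gamma$ on $[s_j,e_j]$ runs monotonically along a straight line segment, which may be a single point; 2. for $0\le j<m$, $\gamma$ on $[e_j,s_{j+1}]$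 runs monotonically along an arc, not a single point, which lies on the boundary of $X$ and on the graph of some $H_{i_j}$, over an interval of the coordinate $u_{\theta_{i_j}}$ on which $f_{i_j}$ is strictly convex (so the arc lies in a convex upward part of a side, in that side's own coordinate frame); 3. for $0<j<m$, if the segment on $[s_j,e_j]$ is a single point, then the arcs before and after it lie on graphs with different indices, $i_{j-1}\ne i_j$. In particular, $\gamma$ is described by finitely many algebraic equations: there are finitely many nonzero polynomials $q_1,\dots,q_N\in\mathbb R[x,y]$, angles $\beta_j$ and real numbers $c_j,d_j$ with $$\gamma([a,b])=\bigcup_{j=1}^N\{p\in\mathbb R^2 : q_j(p)=0,\ c_j\le u_{\beta_j}(p)\le d_j\}.$$ -/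

import Mathlib

/-- The Euclidean plane, with its Euclidean norm. -/
abbrev Plane : Type := EuclideanSpace ℝ (Fin 2)

/-- First coordinate of `p` in the coordinate frame rotated by the angle `θ`. -/
noncomputable def frameX (θ : ℝ) (p : Plane) : ℝ := Real.cos θ * p 0 + Real.sin θ * p 1

/-- Second coordinate of `p` in the coordinate frame rotated by the angle `θ`. -/
noncomputable def frameY (θ : ℝ) (p : Plane) : ℝ := -Real.sin θ * p 0 + Real.cos θ * p 1

/-- Data of a polynomial half plane: the angle of its own coordinate frame, and the polynomial
whose graph, drawn in that frame, bounds it from above. (Translations of the frame are absorbed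
by the polynomial.) -/
structure PolyHalfPlane where
  angle : ℝ
  poly : Polynomial ℝ

namespace PolyHalfPlane

/-- The closed region on or below the graph, in the rotated frame:
`f (cos θ x + sin θ y) - (- sin θ x + cos θ y) ≥ 0`. -/
def carrier (H : PolyHalfPlane) : Set Plane :=
  {p | 0 ≤ H.poly.eval (frameX H.angle p) - frameY H.angle p}

/-- The rotated graph that bounds the polynomial half plane. -/
def graph (H : PolyHalfPlane) : Set Plane :=
  {p | frameY H.angle p = H.poly.eval (frameX H.angle p)}

end PolyHalfPlane

/-- `X` is a region of type I, presented by the polynomial half planes `H i`: it is their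
intersection, and it is simply connected. -/
structure IsTypeIRegion {k : ℕ} (H : Fin k → PolyHalfPlane) (X : Set Plane) : Prop where
  eq_iInter : X = ⋂ i, (H i).carrier
  simplyConnected : SimplyConnectedSpace X

/-- `γ` is piecewise `C²` on `[a, b]`: there are points `a = t₀ < t₁ < ⋯ < tₙ = b` such that `γ` is
`C²` on every closed interval `[tᵢ, tᵢ₊₁]`, with one-sided derivatives at the end points. For
`a < b` this includes continuity on `[a, b]`. -/
def IsPiecewiseC2 (γ : ℝ → Plane) (a b : ℝ) : Prop :=
  ∃ (n : ℕ) (t : Fin (n + 1) → ℝ), StrictMono t ∧ t 0 = a ∧ t (Fin.last n) = b ∧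
    ∀ i : Fin n, ContDiffOn ℝ 2 γ (Set.Icc (t i.castSucc) (t i.succ))

/-- `γ` on `[a, b]` is a piecewise `C²` curve from `A` to `B` inside `X`. -/
structure IsCurveIn (X : Set Plane) (γ : ℝ → Plane) (a b : ℝ) (A B : Plane) : Prop where
  lt : a < b
  piecewiseC2 : IsPiecewiseC2 γ a b
  mapsTo : Set.MapsTo γ (Set.Icc a b) X
  source : γ a = A
  target : γ b = B

/-- The length of `γ` on `[a, b]`: the supremum of the lengths of the inscribed polygonal lines. -/
noncomputable def curveLength (γ : ℝ → Plane) (a b : ℝ) : ENNReal :=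
  eVariationOn γ (Set.Icc a b)

/-- `γ : [a, b] → X` is a shortest-length curve from `A` to `B` in `X`: it has the least length
among all piecewise `C²` curves (over any parameter interval) from `A` to `B` in `X`. -/
structure IsShortestCurve (X : Set Plane) (γ : ℝ → Plane) (a b : ℝ) (A B : Plane) : Prop where
  isCurveIn : IsCurveIn X γ a b A B
  length_le : ∀ (δ : ℝ → Plane) (c d : ℝ), IsCurveIn X δ c d A B →
    curveLength γ a b ≤ curveLength δ c d

/-- On `[s, t]`, the curve `γ` runs monotonically along the straight segment from `γ s` to `γ t`,
which may reduce to a point. -/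
def IsStraightPiece (γ : ℝ → Plane) (s t : ℝ) : Prop :=
  ∃ φ : ℝ → ℝ, MonotoneOn φ (Set.Icc s t) ∧
    ∀ τ ∈ Set.Icc s t, φ τ ∈ Set.Icc (0 : ℝ) 1 ∧ γ τ = AffineMap.lineMap (γ s) (γ t) (φ τ)

/-- On `[s, t]`, the curve `γ` runs monotonically along an arc (not a point) that lies on the
boundary of `X` and on the graph bounding `H`, over an interval on which, in the frame of `H`, that
graph is strictly convex upward. -/
structure IsConvexBoundaryArc (X : Set Plane) (H : PolyHalfPlane) (γ : ℝ → Plane) (s t : ℝ) :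
    Prop where
  lt : s < t
  ne : γ s ≠ γ t
  mem_frontier : ∀ τ ∈ Set.Icc s t, γ τ ∈ frontier X
  mem_graph : ∀ τ ∈ Set.Icc s t, γ τ ∈ H.graph
  monotone : MonotoneOn (fun τ => frameX H.angle (γ τ)) (Set.Icc s t) ∨
    AntitoneOn (fun τ => frameX H.angle (γ τ)) (Set.Icc s t)
  convexUpward : StrictConvexOn ℝ
    (Set.uIcc (frameX H.angle (γ s)) (frameX H.angle (γ t))) (fun x => H.poly.eval x)

/-- `γ` on `[a, b]` is an alternating sequence `S₀ A₀ S₁ A₁ ⋯ Aₘ₋₁ Sₘ` in which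
* `S j`, on `[s j, e j]`, is a straight segment, and
* `A j`, on `[e j, s (j + 1)]`, is a boundary arc of `X` in a convex upward part of a side, on the
  graph with index `i j`.
Arcs are never reduced to points. A segment strictly between two arcs is a single point only where
the two arcs lie on graphs with different indices; `S₀` and `Sₘ` may be single points. -/
def IsAlternating {k : ℕ} (H : Fin k → PolyHalfPlane) (X : Set Plane) (γ : ℝ → Plane)
    (a b : ℝ) : Prop :=
  ∃ (m : ℕ) (s e : Fin (m + 1) → ℝ) (i : Fin m → Fin k),
    s 0 = a ∧ e (Fin.last m) = b ∧
    (∀ j, s j ≤ e j ∧ IsStraightPiece γ (s j) (e j)) ∧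
    (∀ j : Fin m, IsConvexBoundaryArc X (H (i j)) γ (e j.castSucc) (s j.succ)) ∧
    (∀ j j' : Fin m, (j' : ℕ) = j + 1 → γ (s j.succ) = γ (e j.succ) → i j ≠ i j')

/-- The set `Γ` is described by finitely many algebraic equations: it is a finite union of pieces,
each of which is cut out by one nonzero polynomial equation in the two plane coordinates, with one
coordinate of some rotated frame ranging over a closed interval. -/
def IsDescribedByAlgebraicEquations (Γ : Set Plane) : Prop :=
  ∃ (N : ℕ) (q : Fin N → MvPolynomial (Fin 2) ℝ) (θ c d : Fin N → ℝ),
    (∀ j, q j ≠ 0) ∧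
    Γ = ⋃ j, {p : Plane | MvPolynomial.eval (fun l => p l) (q j) = 0 ∧
      frameX (θ j) p ∈ Set.Icc (c j) (d j)}

/-! Parametrize the shortest curve by arc length as `g` on `[0, L]`. Everything after that uses only
`IsTaut`: `g` stays in the region, is 1-Lipschitz, and between two of its points is no longer than
the chord or an arc of a bounding graph, whenever that chord or arc stays in the region.

Locally, to the right of each time and by reversal to the left, `g` is one straight segment or one
convex arc (`exists_piece_right`). Call a contact with a graph convex if the second derivative of
its polynomial is nonnegative there. If convex contacts accumulate at `t`, they do so on one graph
and on one side of `g t`. Along that graph every constraint is a polynomial in the parameter. It is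
nonnegative at parameters tending to `0`, hence on a whole interval, so the arc from `g t` to a
nearby contact lies in the region and is convex. Since `g` stays below this graph and is no longer
than the arc, nearest-point projection to the epigraph forces `g` onto the arc
(`mem_arc_of_length_le`). If convex contacts do not accumulate, only strictly concave contacts could
remain. These cannot occur, because short chords there are admissible, so `g` would be straight, and
strict concavity then excludes the contact (`false_of_concave_contact`). Without contacts `g` is
straight.

Two straight pieces that meet have no corner and merge (`straight_trans`), and consecutive arcs on
the same graph merge. Continuous induction along `[0, L]` therefore produces a finite alternating
chain. Each piece of the chain is the part of a polynomial graph, in a suitable frame, over an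
interval, which gives the algebraic description. -/

open Set Filter Topology

/-! ### Rotated coordinate frames. -/

theorem frameX_add (θ : ℝ) (p q : Plane) : frameX θ (p + q) = frameX θ p + frameX θ q := by
  simp [frameX]; ring

theorem frameY_add (θ : ℝ) (p q : Plane) : frameY θ (p + q) = frameY θ p + frameY θ q := by
  simp [frameY]; ring

theorem frameX_smul (θ c : ℝ) (p : Plane) : frameX θ (c • p) = c * frameX θ p := by
  simp [frameX]; ring

theorem frameY_smul (θ c : ℝ) (p : Plane) : frameY θ (c • p) = c * frameY θ p := by
  simp [frameY]; ring

theorem frameX_sub (θ : ℝ) (p q : Plane) : frameX θ (p - q) = frameX θ p - frameX θ q := by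
  simp [frameX]; ring

theorem frameY_sub (θ : ℝ) (p q : Plane) : frameY θ (p - q) = frameY θ p - frameY θ q := by
  simp [frameY]; ring

theorem norm_sq_eq_frame (θ : ℝ) (p : Plane) : ‖p‖ ^ 2 = frameX θ p ^ 2 + frameY θ p ^ 2 := by
  rw [EuclideanSpace.norm_sq_eq, Fin.sum_univ_two, Real.norm_eq_abs, Real.norm_eq_abs, sq_abs,
    sq_abs, frameX, frameY]
  linear_combination (-(p 0) ^ 2 - p 1 ^ 2) * Real.sin_sq_add_cos_sq θ

theorem dist_sq_eq_frame (θ : ℝ) (p q : Plane) :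
    dist p q ^ 2 = (frameX θ p - frameX θ q) ^ 2 + (frameY θ p - frameY θ q) ^ 2 := by
  rw [dist_eq_norm, norm_sq_eq_frame θ, frameX_sub, frameY_sub]

theorem abs_frameX_sub_le (θ : ℝ) (p q : Plane) : |frameX θ p - frameX θ q| ≤ dist p q := by
  apply abs_le_of_sq_le_sq _ dist_nonneg
  rw [dist_sq_eq_frame θ]; nlinarith [sq_nonneg (frameY θ p - frameY θ q)]

theorem frame_ext (θ : ℝ) {p q : Plane} (hx : frameX θ p = frameX θ q)
    (hy : frameY θ p = frameY θ q) : p = q := by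
  have := dist_sq_eq_frame θ p q
  rw [hx, hy] at this
  simpa using this

@[fun_prop]
theorem continuous_frameX (θ : ℝ) : Continuous (frameX θ) := by
  unfold frameX; fun_prop

@[fun_prop]
theorem continuous_frameY (θ : ℝ) : Continuous (frameY θ) := by
  unfold frameY; fun_prop

theorem frameX_lineMap (θ : ℝ) (p q : Plane) (t : ℝ) :
    frameX θ (AffineMap.lineMap p q t) = (1 - t) * frameX θ p + t * frameX θ q := by
  rw [AffineMap.lineMap_apply_module, frameX_add, frameX_smul, frameX_smul]

theorem frameY_lineMap (θ : ℝ) (p q : Plane) (t : ℝ) :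
    frameY θ (AffineMap.lineMap p q t) = (1 - t) * frameY θ p + t * frameY θ q := by
  rw [AffineMap.lineMap_apply_module, frameY_add, frameY_smul, frameY_smul]

/-- The point with coordinates `u`, `v` in the frame rotated by `θ`. -/
noncomputable def framePoint (θ u v : ℝ) : Plane :=
  !₂[Real.cos θ * u - Real.sin θ * v, Real.sin θ * u + Real.cos θ * v]

@[simp]
theorem frameX_framePoint (θ u v : ℝ) : frameX θ (framePoint θ u v) = u := by
  simp only [frameX, framePoint, PiLp.toLp_apply, Matrix.cons_val_zero, Matrix.cons_val_one]
  linear_combination u * Real.sin_sq_add_cos_sq θ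

@[simp]
theorem frameY_framePoint (θ u v : ℝ) : frameY θ (framePoint θ u v) = v := by
  simp only [frameY, framePoint, PiLp.toLp_apply, Matrix.cons_val_zero, Matrix.cons_val_one]
  linear_combination v * Real.sin_sq_add_cos_sq θ

/-! ### Bounding graphs and the signed vertical distance to them. -/

namespace PolyHalfPlane

/-- The graph of `H`, parametrized by the first coordinate of its own frame. -/
noncomputable def curve (H : PolyHalfPlane) (u : ℝ) : Plane :=
  framePoint H.angle u (H.poly.eval u)

/-- The vertical distance, in the frame of `H`, from a point up to the graph. -/
noncomputable def gap (H : PolyHalfPlane) (p : Plane) : ℝ :=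
  H.poly.eval (frameX H.angle p) - frameY H.angle p

theorem mem_carrier_iff {H : PolyHalfPlane} {p : Plane} : p ∈ H.carrier ↔ 0 ≤ H.gap p := Iff.rfl

theorem mem_graph_iff {H : PolyHalfPlane} {p : Plane} : p ∈ H.graph ↔ H.gap p = 0 := by
  unfold graph gap
  rw [Set.mem_ofPred_eq, sub_eq_zero, eq_comm]

@[simp]
theorem frameX_curve (H : PolyHalfPlane) (u : ℝ) : frameX H.angle (H.curve u) = u :=
  frameX_framePoint _ _ _

@[simp]
theorem frameY_curve (H : PolyHalfPlane) (u : ℝ) :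
    frameY H.angle (H.curve u) = H.poly.eval u :=
  frameY_framePoint _ _ _

theorem curve_mem_graph (H : PolyHalfPlane) (u : ℝ) : H.curve u ∈ H.graph := by
  simp [graph]

theorem curve_frameX {H : PolyHalfPlane} {p : Plane} (hp : p ∈ H.graph) :
    H.curve (frameX H.angle p) = p :=
  frame_ext H.angle (by simp) (by rw [frameY_curve]; exact hp.symm)

theorem eq_of_mem_graph {H : PolyHalfPlane} {p q : Plane} (hp : p ∈ H.graph) (hq : q ∈ H.graph)
    (h : frameX H.angle p = frameX H.angle q) : p = q := by
  rw [← curve_frameX hp, h, curve_frameX hq]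

theorem contDiff_curve (H : PolyHalfPlane) : ContDiff ℝ 2 H.curve := by
  have : ContDiff ℝ 2 (fun u => H.poly.eval u) := by
    simpa using H.poly.contDiff_aeval (𝕜 := ℝ) 2
  unfold curve framePoint
  rw [contDiff_piLp]
  intro i
  fin_cases i <;> simp <;> fun_prop

@[fun_prop]
theorem continuous_gap (H : PolyHalfPlane) : Continuous H.gap := by
  unfold gap; fun_prop

/-- Moving upward in the frame of `H` from a point of the graph leaves the half plane at once. -/
theorem mem_frontier_of_mem_graph {H : PolyHalfPlane} {X : Set Plane} (hX : X ⊆ H.carrier)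
    {p : Plane} (hp : p ∈ X) (hg : p ∈ H.graph) : p ∈ frontier X := by
  rw [frontier_eq_closure_inter_closure]
  refine ⟨subset_closure hp, ?_⟩
  have hc : Filter.Tendsto (fun t : ℝ => p + t • framePoint H.angle 0 1)
      (nhdsWithin 0 (Ioi 0)) (nhds p) := by
    have : Continuous (fun t : ℝ => p + t • framePoint H.angle 0 1) := by fun_prop
    simpa using (this.tendsto 0).mono_left nhdsWithin_le_nhds
  refine mem_closure_of_tendsto hc ?_
  filter_upwards [self_mem_nhdsWithin] with t ht hmem
  have h0 := mem_graph_iff.1 hg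
  have h1 := mem_carrier_iff.1 (hX hmem)
  simp only [gap, frameX_add, frameY_add, frameX_smul, frameY_smul, frameX_framePoint,
    frameY_framePoint, mul_zero, add_zero, mul_one] at h0 h1
  have : (0 : ℝ) < t := ht
  linarith

end PolyHalfPlane

/-! ### Gluing and restricting piecewise C² curves. -/

/-- `γ` is piecewise `C²` on `[a, b]`, as an inductive predicate that adds one `C²` piece at a
time; an empty partition is allowed. -/
inductive PiecewiseC2From (γ : ℝ → Plane) (a : ℝ) : ℝ → Prop
  | refl : PiecewiseC2From γ a a
  | step {b c : ℝ} : PiecewiseC2From γ a b → b < c → ContDiffOn ℝ 2 γ (Icc b c) →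
      PiecewiseC2From γ a c

namespace PiecewiseC2From

variable {γ δ : ℝ → Plane} {a b c x y : ℝ}

theorem le (h : PiecewiseC2From γ a b) : a ≤ b := by
  induction h with
  | refl => exact le_rfl
  | step _ hlt _ ih => exact ih.trans hlt.le

theorem isPiecewiseC2 (h : PiecewiseC2From γ a b) : IsPiecewiseC2 γ a b := by
  induction h with
  | refl => exact ⟨0, fun _ => a, fun i j hij => absurd hij (by omega), rfl, rfl, fun i => i.elim0⟩
  | @step b c _ hlt hC ih =>
    obtain ⟨n, t, hmono, h0, hn, ht⟩ := ih
    refine ⟨n + 1, Fin.snoc t c, ?_, ?_, ?_, ?_⟩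
    · rw [Fin.strictMono_iff_lt_succ]
      intro i
      induction i using Fin.lastCases with
      | last => simpa [Fin.succ_last, hn] using hlt
      | cast i =>
        rw [Fin.succ_castSucc, Fin.snoc_castSucc, Fin.snoc_castSucc]
        exact hmono i.castSucc_lt_succ
    · rw [← Fin.castSucc_zero, Fin.snoc_castSucc, h0]
    · simp
    · intro i
      induction i using Fin.lastCases with
      | last => simpa [Fin.succ_last, hn] using hC
      | cast i =>
        rw [Fin.succ_castSucc, Fin.snoc_castSucc, Fin.snoc_castSucc]
        exact ht i

theorem of_isPiecewiseC2 (h : IsPiecewiseC2 γ a b) : PiecewiseC2From γ a b := by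
  obtain ⟨n, t, hmono, rfl, rfl, ht⟩ := h
  suffices ∀ j : Fin (n + 1), PiecewiseC2From γ (t 0) (t j) from this _
  intro j
  induction j using Fin.induction with
  | zero => exact refl
  | succ i ih => exact ih.step (hmono i.castSucc_lt_succ) (ht i)

theorem trans (h : PiecewiseC2From γ a b) (h' : PiecewiseC2From γ b c) :
    PiecewiseC2From γ a c := by
  induction h' with
  | refl => exact h
  | step _ hlt hC ih => exact ih.step hlt hC

theorem congr (h : PiecewiseC2From γ a b) (he : EqOn δ γ (Icc a b)) :
    PiecewiseC2From δ a b := by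
  induction h with
  | refl => exact refl
  | step h hlt hC ih =>
    exact (ih (he.mono (Icc_subset_Icc_right hlt.le))).step hlt
      (hC.congr (he.mono (Icc_subset_Icc_left h.le)))

theorem restrict_right (h : PiecewiseC2From γ a b) (hx : x ∈ Icc a b) :
    PiecewiseC2From γ a x := by
  induction h with
  | refl => rw [show x = a from le_antisymm hx.2 hx.1]; exact refl
  | @step b c h hlt hC ih =>
    rcases le_or_gt x b with hxb | hxb
    · exact ih ⟨hx.1, hxb⟩
    · exact h.step hxb (hC.mono (Icc_subset_Icc_right hx.2))

theorem restrict_left (h : PiecewiseC2From γ a b) (hx : x ∈ Icc a b) :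
    PiecewiseC2From γ x b := by
  induction h with
  | refl => rw [show x = a from le_antisymm hx.2 hx.1]; exact refl
  | @step b c h hlt hC ih =>
    rcases le_or_gt x b with hxb | hxb
    · exact (ih ⟨hx.1, hxb⟩).step hlt hC
    · rcases hx.2.eq_or_lt with rfl | hxc
      · exact refl
      · exact refl.step hxc (hC.mono (Icc_subset_Icc_left hxb.le))

theorem of_contDiff (h : ContDiff ℝ 2 γ) (hab : a ≤ b) : PiecewiseC2From γ a b := by
  rcases hab.eq_or_lt with rfl | hab
  · exact refl
  · exact refl.step hab h.contDiffOn

/-- A Lipschitz bound makes the length finite and arc length continuous. The constants of the pieces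
are added, which is crude but sufficient. -/
theorem exists_dist_le (h : PiecewiseC2From γ a b) :
    ∃ K : ℝ, 0 ≤ K ∧ ∀ x ∈ Icc a b, ∀ y ∈ Icc a b, x ≤ y → dist (γ x) (γ y) ≤ K * (y - x) := by
  induction h with
  | refl =>
    refine ⟨0, le_rfl, fun x hx y hy _ => ?_⟩
    simp [show x = y from (le_antisymm hx.2 hx.1).trans (le_antisymm hy.1 hy.2)]
  | @step b c h hlt hC ih =>
    obtain ⟨K, hK0, hK⟩ := ih
    obtain ⟨K', hK'⟩ := hC.exists_lipschitzOnWith (by norm_num) (convex_Icc b c) isCompact_Icc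
    have hb : b ∈ Icc a b := ⟨h.le, le_rfl⟩
    have hb' : b ∈ Icc b c := ⟨le_rfl, hlt.le⟩
    have hL : ∀ x ∈ Icc b c, ∀ y ∈ Icc b c, x ≤ y → dist (γ x) (γ y) ≤ K' * (y - x) := by
      intro x hx y hy hxy
      have := hK'.dist_le_mul x hx y hy
      rwa [dist_comm x y, Real.dist_eq, abs_of_nonneg (sub_nonneg.2 hxy)] at this
    have h1 : K ≤ K + K' := le_add_of_nonneg_right K'.2
    have h2 : (K' : ℝ) ≤ K + K' := le_add_of_nonneg_left hK0
    refine ⟨K + K', add_nonneg hK0 K'.2, fun x hx y hy hxy => ?_⟩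
    rcases le_total y b with hyb | hyb
    · exact (hK x ⟨hx.1, hxy.trans hyb⟩ y ⟨hy.1, hyb⟩ hxy).trans
        (mul_le_mul_of_nonneg_right h1 (sub_nonneg.2 hxy))
    rcases le_total x b with hxb | hxb
    · have e1 := (hK x ⟨hx.1, hxb⟩ b hb hxb).trans
        (mul_le_mul_of_nonneg_right h1 (sub_nonneg.2 hxb))
      have e2 := (hL b hb' y ⟨hyb, hy.2⟩ hyb).trans
        (mul_le_mul_of_nonneg_right h2 (sub_nonneg.2 hyb))
      have := dist_triangle (γ x) (γ b) (γ y)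
      linarith
    · exact (hL x ⟨hxb, hx.2⟩ y ⟨hyb, hy.2⟩ hxy).trans
        (mul_le_mul_of_nonneg_right h2 (sub_nonneg.2 hxy))

end PiecewiseC2From

/-! ### Length, local competitors and arc-length parametrization. -/

/-- A bound for the length of a curve by the increment of a potential. -/
theorem eVariationOn_Icc_le_of_dist_le {E : Type*} [PseudoMetricSpace E] {h : ℝ → E} {ψ : ℝ → ℝ}
    {x y : ℝ} (hxy : x ≤ y)
    (H : ∀ s ∈ Icc x y, ∀ t ∈ Icc x y, s ≤ t → dist (h s) (h t) ≤ ψ t - ψ s) :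
    eVariationOn h (Icc x y) ≤ ENNReal.ofReal (ψ y - ψ x) := by
  have hmono : MonotoneOn ψ (Icc x y) := fun s hs t ht hst =>
    sub_nonneg.1 (dist_nonneg.trans (H s hs t ht hst))
  have hle : eVariationOn h (Icc x y) ≤ eVariationOn ψ (Icc x y) := by
    refine iSup_le fun p => ?_
    refine le_trans (Finset.sum_le_sum fun i _ => ?_)
      (eVariationOn.sum_le (f := ψ) (n := p.1) p.2.2.1 p.2.2.2)
    have := H _ (p.2.2.2 i) _ (p.2.2.2 (i + 1)) (p.2.2.1 (Nat.le_succ i))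
    rw [edist_comm, edist_dist, edist_dist, Real.dist_eq]
    exact ENNReal.ofReal_le_ofReal (this.trans (le_abs_self _))
  have := (hmono.eVariationOn_eq (left_mem_Icc.2 hxy) (right_mem_Icc.2 hxy)).le
  rw [inter_self] at this
  exact hle.trans this

namespace IsShortestCurve

variable {X : Set Plane} {γ : ℝ → Plane} {a b : ℝ} {A B : Plane}

/-- Minimality localizes: paste `δ` over `[x, y]` and cancel the common lengths outside, which is
legitimate because they are finite. -/
theorem eVariationOn_le_of_contDiff (h : IsShortestCurve X γ a b A B) {x y : ℝ}
    (hx : a ≤ x) (hxy : x ≤ y) (hy : y ≤ b) (hfin : eVariationOn γ (Icc a b) ≠ ⊤)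
    {δ : ℝ → Plane} (hδ : ContDiff ℝ 2 δ) (h1 : δ x = γ x) (h2 : δ y = γ y)
    (hX : ∀ t ∈ Icc x y, δ t ∈ X) :
    eVariationOn γ (Icc x y) ≤ eVariationOn δ (Icc x y) := by
  classical
  have hpc := PiecewiseC2From.of_isPiecewiseC2 h.isCurveIn.piecewiseC2
  let η : ℝ → Plane := fun t => if t ∈ Icc x y then δ t else γ t
  have e1 : EqOn η γ (Icc a x) := by
    intro t ht
    by_cases hm : t ∈ Icc x y
    · have : t = x := le_antisymm ht.2 hm.1
      subst this; simp [η, h1]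
    · simp only [η, if_neg hm]
  have e2 : EqOn η δ (Icc x y) := fun t ht => by simp only [η, if_pos ht]
  have e3 : EqOn η γ (Icc y b) := by
    intro t ht
    by_cases hm : t ∈ Icc x y
    · have : t = y := le_antisymm hm.2 ht.1
      subst this; simp [η, h2]
    · simp only [η, if_neg hm]
  have hη : PiecewiseC2From η a b :=
    (((hpc.restrict_right ⟨hx, hxy.trans hy⟩).congr e1).trans
      ((PiecewiseC2From.of_contDiff hδ hxy).congr e2)).trans
      ((hpc.restrict_left ⟨hx.trans hxy, hy⟩).congr e3)
  have hcurve : IsCurveIn X η a b A B := by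
    refine ⟨h.isCurveIn.lt, hη.isPiecewiseC2, fun t ht => ?_, ?_, ?_⟩
    · by_cases hm : t ∈ Icc x y
      · rw [e2 hm]; exact hX t hm
      · simp only [η, if_neg hm]; exact h.isCurveIn.mapsTo ht
    · rw [e1 ⟨le_rfl, hx⟩, h.isCurveIn.source]
    · rw [e3 ⟨hy, le_rfl⟩, h.isCurveIn.target]
  have hle := h.length_le η a b hcurve
  have split : ∀ f : ℝ → Plane, eVariationOn f (Icc a x) + eVariationOn f (Icc x y) +
      eVariationOn f (Icc y b) = eVariationOn f (Icc a b) := by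
    intro f
    have s1 := eVariationOn.Icc_add_Icc f (s := univ) hx hxy (mem_univ _)
    have s2 := eVariationOn.Icc_add_Icc f (s := univ) (hx.trans hxy) hy (mem_univ _)
    simp only [univ_inter] at s1 s2
    rw [s1, s2]
  rw [curveLength, curveLength, ← split γ, ← split η, eVariationOn.congr e1,
    eVariationOn.congr e2, eVariationOn.congr e3] at hle
  have f1 : eVariationOn γ (Icc a x) ≠ ⊤ := ne_top_of_le_ne_top hfin
    (eVariationOn.mono γ (Icc_subset_Icc_right (hxy.trans hy)))
  have f3 : eVariationOn γ (Icc y b) ≠ ⊤ := ne_top_of_le_ne_top hfin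
    (eVariationOn.mono γ (Icc_subset_Icc_left (hx.trans hxy)))
  rwa [ENNReal.add_le_add_iff_right f3, ENNReal.add_le_add_iff_left f1] at hle

end IsShortestCurve

/-- The properties of a shortest curve parametrized by arc length that determine its shape: it
lies in the region, it does not exceed unit speed, and between two of its points it is at most as
long as the segment and as any arc of a bounding graph that stay inside the region. -/
structure IsTaut {k : ℕ} (H : Fin k → PolyHalfPlane) (g : ℝ → Plane) (L : ℝ) : Prop where
  gap_nonneg : ∀ s ∈ Icc 0 L, ∀ i, 0 ≤ (H i).gap (g s)
  dist_le : ∀ s ∈ Icc 0 L, ∀ t ∈ Icc 0 L, dist (g s) (g t) ≤ |s - t|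
  le_dist : ∀ s ∈ Icc 0 L, ∀ t ∈ Icc 0 L,
    (∀ r ∈ Icc (0 : ℝ) 1, ∀ i, 0 ≤ (H i).gap (AffineMap.lineMap (g s) (g t) r)) →
      |s - t| ≤ dist (g s) (g t)
  le_eVariationOn : ∀ s ∈ Icc 0 L, ∀ t ∈ Icc 0 L, ∀ i, g s ∈ (H i).graph → g t ∈ (H i).graph →
    (∀ w ∈ uIcc (frameX (H i).angle (g s)) (frameX (H i).angle (g t)),
      ∀ j, 0 ≤ (H j).gap ((H i).curve w)) →
    ENNReal.ofReal |s - t| ≤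
      eVariationOn (H i).curve (uIcc (frameX (H i).angle (g s)) (frameX (H i).angle (g t)))

theorem contDiff_lineMap_real (x y : ℝ) (c d : ℝ) :
    ContDiff ℝ 2 (fun t : ℝ => c + (t - x) / (y - x) * (d - c)) := by
  fun_prop

/-- `ℓ` is arc length from `a`, and `T` is a chosen right inverse of it, possibly discontinuous.
Nevertheless `γ ∘ T` is the arc-length parametrization, since `γ` is constant wherever `ℓ` is. -/
theorem IsShortestCurve.exists_isTaut {k : ℕ} {H : Fin k → PolyHalfPlane} {X : Set Plane}
    (hX : X = ⋂ i, (H i).carrier) {γ : ℝ → Plane} {a b : ℝ} {A B : Plane}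
    (h : IsShortestCurve X γ a b A B) :
    ∃ (ℓ T : ℝ → ℝ) (L : ℝ), 0 ≤ L ∧ MonotoneOn ℓ (Icc a b) ∧ ℓ a = 0 ∧ ℓ b = L ∧
      (∀ s ∈ Icc 0 L, T s ∈ Icc a b ∧ ℓ (T s) = s) ∧
      (∀ t ∈ Icc a b, γ (T (ℓ t)) = γ t) ∧ IsTaut H (γ ∘ T) L := by
  have hab := h.isCurveIn.lt.le
  have hmemX : ∀ p, p ∈ X ↔ ∀ i, 0 ≤ (H i).gap p := by
    intro p; rw [hX, mem_iInter]; rfl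
  obtain ⟨K, hK0, hK⟩ :=
    (PiecewiseC2From.of_isPiecewiseC2 h.isCurveIn.piecewiseC2).exists_dist_le
  have hV : ∀ x y, a ≤ x → x ≤ y → y ≤ b →
      eVariationOn γ (Icc x y) ≤ ENNReal.ofReal (K * y - K * x) := by
    intro x y hx hxy hy
    refine eVariationOn_Icc_le_of_dist_le (ψ := fun t => K * t) hxy fun s hs t ht hst => ?_
    have := hK s ⟨hx.trans hs.1, hs.2.trans hy⟩ t ⟨hx.trans ht.1, ht.2.trans hy⟩ hst
    linarith
  have hfin : ∀ x y, a ≤ x → x ≤ y → y ≤ b → eVariationOn γ (Icc x y) ≠ ⊤ := fun x y hx hxy hy =>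
    ne_top_of_le_ne_top ENNReal.ofReal_ne_top (hV x y hx hxy hy)
  set ℓ : ℝ → ℝ := fun t => (eVariationOn γ (Icc a t)).toReal with hℓ
  have hdiff : ∀ x y, a ≤ x → x ≤ y → y ≤ b →
      eVariationOn γ (Icc x y) = ENNReal.ofReal (ℓ y - ℓ x) := by
    intro x y hx hxy hy
    have s1 := eVariationOn.Icc_add_Icc γ (s := univ) hx hxy (mem_univ _)
    simp only [univ_inter] at s1
    have f1 := hfin a x le_rfl hx (hxy.trans hy)
    have f2 := hfin x y hx hxy hy
    have : ℓ y - ℓ x = (eVariationOn γ (Icc x y)).toReal := by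
      simp only [hℓ]
      rw [← s1, ENNReal.toReal_add f1 f2]; ring
    rw [this, ENNReal.ofReal_toReal f2]
  have hmono : MonotoneOn ℓ (Icc a b) := fun x hx y hy hxy =>
    ENNReal.toReal_mono (hfin a y le_rfl hy.1 hy.2)
      (eVariationOn.mono γ (Icc_subset_Icc_right hxy))
  have hd : ∀ x ∈ Icc a b, ∀ y ∈ Icc a b, x ≤ y → dist (γ x) (γ y) ≤ ℓ y - ℓ x := by
    intro x hx y hy hxy
    have e := eVariationOn.edist_le γ (s := Icc x y) (left_mem_Icc.2 hxy) (right_mem_Icc.2 hxy)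
    rw [hdiff x y hx.1 hxy hy.2, edist_dist] at e
    exact (ENNReal.ofReal_le_ofReal_iff (sub_nonneg.2 (hmono hx hy hxy))).1 e
  have hcont : ContinuousOn ℓ (Icc a b) := by
    have : LipschitzOnWith ⟨K, hK0⟩ ℓ (Icc a b) := by
      refine LipschitzOnWith.of_dist_le_mul ?_
      have key : ∀ x ∈ Icc a b, ∀ y ∈ Icc a b, x ≤ y → dist (ℓ x) (ℓ y) ≤ K * dist x y := by
        intro x hx y hy hxy
        have e := hV x y hx.1 hxy hy.2
        rw [hdiff x y hx.1 hxy hy.2, ENNReal.ofReal_le_ofReal_iff (by nlinarith)] at e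
        rw [dist_comm, dist_comm x, Real.dist_eq, Real.dist_eq,
          abs_of_nonneg (sub_nonneg.2 hxy), abs_of_nonneg (sub_nonneg.2 (hmono hx hy hxy))]
        linarith
      intro x hx y hy
      rcases le_total x y with hxy | hxy
      · exact key x hx y hy hxy
      · rw [dist_comm, dist_comm x]; exact key y hy x hx hxy
    exact this.continuousOn
  have hℓa : ℓ a = 0 := by simp [hℓ, eVariationOn.subsingleton]
  have hivt := intermediate_value_Icc hab hcont
  rw [hℓa] at hivt
  have hex : ∀ s : ℝ, ∃ t : ℝ, s ∈ Icc 0 (ℓ b) → t ∈ Icc a b ∧ ℓ t = s := by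
    intro s
    by_cases hs : s ∈ Icc 0 (ℓ b)
    · obtain ⟨t, ht, hts⟩ := hivt hs
      exact ⟨t, fun _ => ⟨ht, hts⟩⟩
    · exact ⟨0, fun h => absurd h hs⟩
  choose T hT using hex
  have hℓmem : ∀ t ∈ Icc a b, ℓ t ∈ Icc 0 (ℓ b) := fun t ht =>
    ⟨hℓa ▸ hmono (left_mem_Icc.2 hab) ht ht.1, hmono ht (right_mem_Icc.2 hab) ht.2⟩
  have hd' : ∀ x ∈ Icc a b, ∀ y ∈ Icc a b, dist (γ x) (γ y) ≤ |ℓ x - ℓ y| := by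
    intro x hx y hy
    rcases le_total x y with hxy | hxy
    · rw [abs_sub_comm]; exact (hd x hx y hy hxy).trans (le_abs_self _)
    · rw [dist_comm]; exact (hd y hy x hx hxy).trans (le_abs_self _)
  refine ⟨ℓ, T, ℓ b, (hℓmem b (right_mem_Icc.2 hab)).1, hmono, hℓa, rfl, hT, ?_, ?_⟩
  · intro t ht
    have h1 := hT _ (hℓmem t ht)
    have := hd' _ h1.1 _ ht
    rw [h1.2, sub_self, abs_zero] at this
    exact dist_le_zero.1 this
  have hmain : ∀ s ∈ Icc 0 (ℓ b), ∀ t ∈ Icc 0 (ℓ b), s ≤ t → ∀ δ : ℝ → Plane, ContDiff ℝ 2 δ →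
      δ (T s) = γ (T s) → δ (T t) = γ (T t) → (∀ r ∈ Icc (T s) (T t), δ r ∈ X) →
      ENNReal.ofReal (t - s) ≤ eVariationOn δ (Icc (T s) (T t)) := by
    intro s hs t ht hst δ hδ h1 h2 h3
    rcases hst.eq_or_lt with rfl | hst
    · simp
    have hTs := hT s hs
    have hTt := hT t ht
    have hlt : T s < T t := by
      by_contra hcon
      have := hmono hTt.1 hTs.1 (not_lt.1 hcon)
      rw [hTs.2, hTt.2] at this
      linarith
    have := h.eVariationOn_le_of_contDiff hTs.1.1 hlt.le hTt.1.2 (hfin a b le_rfl hab le_rfl)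
      hδ h1 h2 h3
    rwa [hdiff _ _ hTs.1.1 hlt.le hTt.1.2, hTs.2, hTt.2] at this
  have hTlt : ∀ s ∈ Icc 0 (ℓ b), ∀ t ∈ Icc 0 (ℓ b), s < t → T s < T t := by
    intro s hs t ht hst
    by_contra hcon
    have := hmono (hT t ht).1 (hT s hs).1 (not_lt.1 hcon)
    rw [(hT s hs).2, (hT t ht).2] at this
    linarith
  have hr : ∀ {x y r : ℝ}, x < y → r ∈ Icc x y → (r - x) / (y - x) ∈ Icc (0 : ℝ) 1 := by
    intro x y r hxy hr
    have : 0 < y - x := sub_pos.2 hxy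
    exact ⟨div_nonneg (sub_nonneg.2 hr.1) this.le, (div_le_one this).2 (by linarith [hr.2])⟩
  refine ⟨fun s hs => (hmemX _).1 (h.isCurveIn.mapsTo (hT s hs).1), ?_, ?_, ?_⟩
  · intro s hs t ht
    have := hd' _ (hT s hs).1 _ (hT t ht).1
    rwa [(hT s hs).2, (hT t ht).2] at this
  · have key : ∀ s ∈ Icc 0 (ℓ b), ∀ t ∈ Icc 0 (ℓ b), s < t →
        (∀ r ∈ Icc (0 : ℝ) 1, ∀ i,
          0 ≤ (H i).gap (AffineMap.lineMap ((γ ∘ T) s) ((γ ∘ T) t) r)) →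
        t - s ≤ dist ((γ ∘ T) s) ((γ ∘ T) t) := by
      intro s hs t ht hst hseg
      have hlt := hTlt s hs t ht hst
      have hne : T t - T s ≠ 0 := (sub_pos.2 hlt).ne'
      let δ : ℝ → Plane := fun r =>
        AffineMap.lineMap (γ (T s)) (γ (T t)) ((r - T s) / (T t - T s))
      have hδ : ContDiff ℝ 2 δ := by
        simp only [δ, AffineMap.lineMap_apply_module']
        fun_prop
      have e := hmain s hs t ht hst.le δ hδ (by simp [δ]) (by simp [δ, div_self hne])
        (fun r hrm => (hmemX _).2 (hseg _ (hr hlt hrm)))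
      refine (ENNReal.ofReal_le_ofReal_iff dist_nonneg).1 (e.trans ?_)
      refine (eVariationOn_Icc_le_of_dist_le
        (ψ := fun r => (r - T s) / (T t - T s) * dist (γ (T s)) (γ (T t))) hlt.le ?_).trans ?_
      · intro x hx y hy hxy
        have hpos : 0 < T t - T s := sub_pos.2 hlt
        simp only [δ]
        rw [dist_lineMap_lineMap, Real.dist_eq, abs_sub_comm, abs_of_nonneg, sub_mul]
        rw [← sub_div]
        exact div_nonneg (by linarith) hpos.le
      · simp [div_self hne]
    intro s hs t ht hseg
    rcases lt_trichotomy s t with hst | rfl | hst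
    · rw [abs_sub_comm, abs_of_pos (sub_pos.2 hst)]; exact key s hs t ht hst hseg
    · simp
    · rw [abs_of_pos (sub_pos.2 hst), dist_comm]
      refine key t ht s hs hst fun r hrm i => ?_
      have := hseg (1 - r) ⟨by linarith [hrm.2], by linarith [hrm.1]⟩ i
      rwa [AffineMap.lineMap_apply_one_sub] at this
  · have key : ∀ s ∈ Icc 0 (ℓ b), ∀ t ∈ Icc 0 (ℓ b), s < t → ∀ i, (γ ∘ T) s ∈ (H i).graph →
        (γ ∘ T) t ∈ (H i).graph →
        (∀ w ∈ uIcc (frameX (H i).angle ((γ ∘ T) s)) (frameX (H i).angle ((γ ∘ T) t)),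
          ∀ j, 0 ≤ (H j).gap ((H i).curve w)) →
        ENNReal.ofReal (t - s) ≤ eVariationOn (H i).curve
          (uIcc (frameX (H i).angle ((γ ∘ T) s)) (frameX (H i).angle ((γ ∘ T) t))) := by
      intro s hs t ht hst i hgs hgt harc
      have hlt := hTlt s hs t ht hst
      have hpos : 0 < T t - T s := sub_pos.2 hlt
      have hne : T t - T s ≠ 0 := hpos.ne'
      simp only [Function.comp_apply] at *
      set c := frameX (H i).angle (γ (T s)) with hc
      set d := frameX (H i).angle (γ (T t)) with hd
      let φ : ℝ → ℝ := fun r => c + (r - T s) / (T t - T s) * (d - c)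
      have hφ : MapsTo φ (Icc (T s) (T t)) (uIcc c d) := by
        intro r hrm
        obtain ⟨r0, r1⟩ := hr hlt hrm
        rcases le_total c d with hcd | hcd
        · rw [uIcc_of_le hcd]
          exact ⟨by simp only [φ]; nlinarith, by simp only [φ]; nlinarith⟩
        · rw [uIcc_of_ge hcd]
          exact ⟨by simp only [φ]; nlinarith, by simp only [φ]; nlinarith⟩
      have e := hmain s hs t ht hst.le ((H i).curve ∘ φ)
        ((H i).contDiff_curve.comp (contDiff_lineMap_real _ _ _ _))
        (by simp [φ, hc, PolyHalfPlane.curve_frameX hgs])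
        (by simp [φ, hd, div_self hne, PolyHalfPlane.curve_frameX hgt])
        (fun r hrm => (hmemX _).2 (harc _ (hφ hrm)))
      refine e.trans ?_
      rcases le_total c d with hcd | hcd
      · refine eVariationOn.comp_le_of_monotoneOn _ φ (fun x _ y _ hxy => ?_) hφ
        have : (x - T s) / (T t - T s) ≤ (y - T s) / (T t - T s) := by gcongr
        simp only [φ]; nlinarith
      · refine eVariationOn.comp_le_of_antitoneOn _ φ (fun x _ y _ hxy => ?_) hφ
        have : (x - T s) / (T t - T s) ≤ (y - T s) / (T t - T s) := by gcongr
        simp only [φ]; nlinarith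
    intro s hs t ht i hgs hgt harc
    rcases lt_trichotomy s t with hst | rfl | hst
    · rw [abs_sub_comm, abs_of_pos (sub_pos.2 hst)]; exact key s hs t ht hst i hgs hgt harc
    · simp
    · rw [abs_of_pos (sub_pos.2 hst), uIcc_comm]
      rw [uIcc_comm] at harc
      exact key t ht s hs hst i hgt hgs harc

/-! ### Nearest-point projection onto closed convex sets. -/

section Projection

variable {F : Type*} [NormedAddCommGroup F] [InnerProductSpace ℝ F]

theorem exists_nearest_point_map [CompleteSpace F] {C : Set F} (hne : C.Nonempty) (hc : IsClosed C)
    (hconv : Convex ℝ C) :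
    ∃ π : F → F, ∀ p, π p ∈ C ∧ ∀ z ∈ C, inner ℝ (p - π p) (z - π p) ≤ 0 := by
  have : ∀ p, ∃ q, q ∈ C ∧ ∀ z ∈ C, inner ℝ (p - q) (z - q) ≤ 0 := by
    intro p
    obtain ⟨q, hq, h⟩ := exists_norm_eq_iInf_of_complete_convex hne hc.isComplete hconv p
    exact ⟨q, hq, (norm_eq_iInf_iff_real_inner_le_zero hconv hq).1 h⟩
  choose π hπ using this
  exact ⟨π, hπ⟩

/-- Firm nonexpansiveness: adding the obtuse-angle inequalities at `π p` and `π q` shows that the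
two summands of `p - q` have nonnegative inner product. The second square on the left measures how
strictly lengths shrink. -/
theorem norm_sq_add_norm_sq_le_of_nearest_point {C : Set F} {π : F → F}
    (hπ : ∀ p, π p ∈ C ∧ ∀ z ∈ C, inner ℝ (p - π p) (z - π p) ≤ 0) (p q : F) :
    ‖π p - π q‖ ^ 2 + ‖(p - π p) - (q - π q)‖ ^ 2 ≤ ‖p - q‖ ^ 2 := by
  have h1 := (hπ p).2 _ (hπ q).1
  have h2 := (hπ q).2 _ (hπ p).1
  have e : p - q = (π p - π q) + ((p - π p) - (q - π q)) := by abel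
  rw [← neg_sub (π p) (π q), inner_neg_right] at h1
  have h3 : 0 ≤ inner ℝ (π p - π q) ((p - π p) - (q - π q)) := by
    rw [inner_sub_right, real_inner_comm _ (π p - π q), real_inner_comm _ (π p - π q)]
    linarith
  conv_rhs => rw [e, norm_add_sq_real]
  linarith

theorem eq_of_nearest_point_of_mem {C : Set F} {π : F → F}
    (hπ : ∀ p, π p ∈ C ∧ ∀ z ∈ C, inner ℝ (p - π p) (z - π p) ≤ 0) {p : F} (hp : p ∈ C) :
    π p = p := by
  have := (hπ p).2 p hp
  rw [real_inner_self_nonpos, sub_eq_zero] at this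
  exact this.symm

/-- A small step from an interior point `π p` towards `p` stays in `C`, which contradicts the obtuse
angle unless `p = π p`. -/
theorem eq_of_nearest_point_mem_nhds {C : Set F} {π : F → F}
    (hπ : ∀ p, π p ∈ C ∧ ∀ z ∈ C, inner ℝ (p - π p) (z - π p) ≤ 0) {p : F}
    (hp : C ∈ nhds (π p)) : π p = p := by
  have hcont : Filter.Tendsto (fun t : ℝ => π p + t • (p - π p)) (nhdsWithin 0 (Ioi 0))
      (nhds (π p)) := by
    have : Continuous (fun t : ℝ => π p + t • (p - π p)) := by fun_prop
    simpa using (this.tendsto 0).mono_left nhdsWithin_le_nhds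
  obtain ⟨t, htC, ht⟩ := ((hcont.eventually hp).and self_mem_nhdsWithin).exists
  have := (hπ p).2 _ htC
  rw [add_sub_cancel_left, inner_smul_right] at this
  have h0 : inner ℝ (p - π p) (p - π p) ≤ 0 := nonpos_of_mul_nonpos_right this ht
  rw [real_inner_self_nonpos, sub_eq_zero] at h0
  exact h0.symm

end Projection

/-! ### Comparing a curve with a convex arc above it. -/

namespace PolyHalfPlane

/-- The part of the epigraph of `H.poly` over `[c, d]`, in the frame of `H`. -/
def epigraphOver (H : PolyHalfPlane) (c d : ℝ) : Set Plane :=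
  {p | frameX H.angle p ∈ Icc c d ∧ H.gap p ≤ 0}

theorem isClosed_epigraphOver (H : PolyHalfPlane) (c d : ℝ) : IsClosed (H.epigraphOver c d) :=
  (isClosed_Icc.preimage (continuous_frameX _)).inter
    (isClosed_le (continuous_gap H) continuous_const)

theorem convex_epigraphOver {H : PolyHalfPlane} {c d : ℝ}
    (h : ConvexOn ℝ (Icc c d) fun w => H.poly.eval w) : Convex ℝ (H.epigraphOver c d) := by
  intro p hp q hq a b ha hb hab
  have h1 := h.2 hp.1 hq.1 ha hb hab
  have h2 := h.1 hp.1 hq.1 ha hb hab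
  have hp2 := hp.2
  have hq2 := hq.2
  simp only [epigraphOver, gap, Set.mem_ofPred_eq, frameX_add, frameX_smul, frameY_add, frameY_smul,
    smul_eq_mul] at *
  exact ⟨h2, by nlinarith⟩

theorem mem_nhds_epigraphOver {H : PolyHalfPlane} {c d : ℝ} {p : Plane}
    (h1 : frameX H.angle p ∈ Ioo c d) (h2 : H.gap p < 0) : H.epigraphOver c d ∈ nhds p := by
  have e1 : ∀ᶠ q in nhds p, frameX H.angle q ∈ Ioo c d :=
    (continuous_frameX H.angle).continuousAt.eventually (isOpen_Ioo.mem_nhds h1)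
  have e2 : ∀ᶠ q in nhds p, H.gap q < 0 :=
    (continuous_gap H).continuousAt.eventually (isOpen_Iio.mem_nhds h2)
  filter_upwards [e1, e2] with q hq1 hq2
  exact ⟨Ioo_subset_Icc_self hq1, hq2.le⟩

end PolyHalfPlane

theorem dist_continuousOn {E : Type*} [PseudoMetricSpace E] {h : ℝ → E} {x y : ℝ}
    (H : ∀ s ∈ Icc x y, ∀ t ∈ Icc x y, dist (h s) (h t) ≤ |s - t|) :
    ContinuousOn h (Icc x y) := by
  have : LipschitzOnWith 1 h (Icc x y) := LipschitzOnWith.of_dist_le_mul fun s hs t ht => by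
    simpa [Real.dist_eq] using H s hs t ht
  exact this.continuousOn

/-- A curve that traverses all points of a graph over `[c, d]` in its interior, starting and
ending at the end points, is at least as long as the graph. -/
theorem eVariationOn_le_of_crossing {E : Type*} [PseudoEMetricSpace E] {h ζ : ℝ → E} {U : ℝ → ℝ}
    {x y c d : ℝ} (hxy : x ≤ y) (hU : ContinuousOn U (Icc x y)) (hUx : U x = c) (hUy : U y = d)
    (hx : h x = ζ c) (hy : h y = ζ d)
    (hmid : ∀ s ∈ Icc x y, U s ∈ Ioo c d → h s = ζ (U s)) :
    eVariationOn ζ (Icc c d) ≤ eVariationOn h (Icc x y) := by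
  classical
  let S : ℝ → Set ℝ := fun w => Icc x y ∩ U ⁻¹' Ici w
  have hSc : ∀ w, IsCompact (S w) := fun w =>
    isCompact_Icc.of_isClosed_subset (hU.preimage_isClosed_of_isClosed isClosed_Icc isClosed_Ici)
      inter_subset_left
  have hyS : ∀ w ≤ d, y ∈ S w := fun w hw => ⟨⟨hxy, le_rfl⟩, by
    change w ≤ U y; rw [hUy]; exact hw⟩
  have hmem : ∀ w ≤ d, sInf (S w) ∈ S w := fun w hw => (hSc w).sInf_mem ⟨y, hyS w hw⟩
  have hlb : ∀ w, ∀ s ∈ S w, sInf (S w) ≤ s := fun w s hs => csInf_le (hSc w).bddBelow hs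
  -- `φ w` is the first time at which `U` reaches `w`. At `w = d` it is reset to `y`, because `h` is
  -- not known to equal `ζ d` at an earlier time with `U = d`.
  let φ : ℝ → ℝ := fun w => if w = d then y else sInf (S w)
  have hφ : MapsTo φ (Icc c d) (Icc x y) := by
    intro w hw
    by_cases hwd : w = d
    · simp only [φ, if_pos hwd]; exact ⟨hxy, le_rfl⟩
    · simp only [φ, if_neg hwd]; exact (hmem w hw.2).1
  have hmono : MonotoneOn φ (Icc c d) := by
    intro v hv w hw hvw
    by_cases hwd : w = d
    · have := (hφ hv).2
      simpa only [φ, if_pos hwd] using this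
    · have hvd : v ≠ d := fun h => hwd (le_antisymm hw.2 (h ▸ hvw))
      simp only [φ, if_neg hwd, if_neg hvd]
      exact hlb v _ ⟨(hmem w hw.2).1, hvw.trans (hmem w hw.2).2⟩
  have heq : EqOn ζ (h ∘ φ) (Icc c d) := by
    intro w hw
    by_cases hwd : w = d
    · rw [Function.comp_apply, show φ w = y from if_pos hwd, hy, hwd]
    by_cases hwc : w = c
    · have h1 : sInf (S w) = x := by
        refine le_antisymm (hlb w x ⟨⟨le_rfl, hxy⟩, ?_⟩) (hmem w hw.2).1.1
        change w ≤ U x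
        rw [hUx, hwc]
      rw [Function.comp_apply, show φ w = x from (if_neg hwd).trans h1, hx, hwc]
    · set s := sInf (S w) with hs
      have hsS : s ∈ S w := hmem w hw.2
      have hUs : U s = w := by
        obtain ⟨r, hr, hrw⟩ := intermediate_value_Icc hsS.1.1
          (hU.mono (Icc_subset_Icc_right hsS.1.2)) (show w ∈ Icc (U x) (U s) from
            ⟨by rw [hUx]; exact hw.1, hsS.2⟩)
        have : s ≤ r := hlb w r ⟨⟨hr.1, hr.2.trans hsS.1.2⟩, hrw.ge⟩
        rw [le_antisymm this hr.2, hrw]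
      have := hmid s hsS.1 (by
        rw [hUs]; exact ⟨lt_of_le_of_ne hw.1 (Ne.symm hwc), lt_of_le_of_ne hw.2 hwd⟩)
      simp only [Function.comp_apply, φ, if_neg hwd, ← hs, this, hUs]
  rw [eVariationOn.congr heq]
  exact eVariationOn.comp_le_of_monotoneOn h φ hmono hφ

/-- Cauchy–Schwarz with the vector `(1 - m ^ 2, 2 * m)`, whose length is `1 + m ^ 2`. -/
theorem mul_add_mul_le_of_sq_add_sq_le {p q r m : ℝ} (hr : 0 ≤ r)
    (h : p ^ 2 + q ^ 2 ≤ r ^ 2) : (1 - m ^ 2) * p + 2 * m * q ≤ (1 + m ^ 2) * r := by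
  refine (le_abs_self _).trans (abs_le_of_sq_le_sq ?_ (by positivity))
  nlinarith [sq_nonneg ((1 - m ^ 2) * q - 2 * m * p), mul_le_mul_of_nonneg_left h
    (sq_nonneg (1 + m ^ 2))]

/-- A curve of unit speed below the graph of a convex polynomial that joins the end points of an
arc of this graph, and is not longer than the arc, runs on the arc. -/
theorem mem_arc_of_length_le {H : PolyHalfPlane} {g : ℝ → Plane} {x y c d : ℝ} (hxy : x ≤ y)
    (hcd : c ≤ d) (hg : ∀ s ∈ Icc x y, ∀ t ∈ Icc x y, dist (g s) (g t) ≤ |s - t|)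
    (hgap : ∀ s ∈ Icc x y, 0 ≤ H.gap (g s)) (hx : g x = H.curve c) (hy : g y = H.curve d)
    (hconv : ConvexOn ℝ (Icc c d) fun w => H.poly.eval w)
    (hlen : ENNReal.ofReal (y - x) ≤ eVariationOn H.curve (Icc c d)) :
    ∀ s ∈ Icc x y, g s ∈ H.graph ∧ frameX H.angle (g s) ∈ Icc c d := by
  set C := H.epigraphOver c d
  have hgapc : ∀ w, H.gap (H.curve w) = 0 := fun w =>
    PolyHalfPlane.mem_graph_iff.1 (H.curve_mem_graph w)
  have hcC : ∀ w ∈ Icc c d, H.curve w ∈ C := fun w hw => ⟨by simpa using hw, (hgapc w).le⟩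
  have hxC : g x ∈ C := hx ▸ hcC c ⟨le_rfl, hcd⟩
  have hyC : g y ∈ C := hy ▸ hcC d ⟨hcd, le_rfl⟩
  obtain ⟨π, hπ⟩ := exists_nearest_point_map ⟨_, hxC⟩ (H.isClosed_epigraphOver c d)
    (PolyHalfPlane.convex_epigraphOver hconv)
  have hπx : π (g x) = g x := eq_of_nearest_point_of_mem hπ hxC
  have hπy : π (g y) = g y := eq_of_nearest_point_of_mem hπ hyC
  let ρ : ℝ → ℝ := fun s => ‖g s - π (g s)‖
  have hsq : ∀ s ∈ Icc x y, ∀ t ∈ Icc x y,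
      dist (π (g s)) (π (g t)) ^ 2 + |ρ s - ρ t| ^ 2 ≤ |s - t| ^ 2 := by
    intro s hs t ht
    have h1 := norm_sq_add_norm_sq_le_of_nearest_point hπ (g s) (g t)
    have h2 : |ρ s - ρ t| ^ 2 ≤ ‖(g s - π (g s)) - (g t - π (g t))‖ ^ 2 :=
      pow_le_pow_left₀ (abs_nonneg _) (abs_norm_sub_norm_le _ _) 2
    have h3 : ‖g s - g t‖ ^ 2 ≤ |s - t| ^ 2 := by
      rw [← dist_eq_norm]
      exact pow_le_pow_left₀ dist_nonneg (hg s hs t ht) 2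
    rw [dist_eq_norm]
    linarith
  have hlip : ∀ s ∈ Icc x y, ∀ t ∈ Icc x y, dist (π (g s)) (π (g t)) ≤ |s - t| := by
    intro s hs t ht
    refine (le_abs_self _).trans (abs_le_of_sq_le_sq ?_ (abs_nonneg _))
    have := hsq s hs t ht
    nlinarith [sq_nonneg (|ρ s - ρ t|)]
  -- The projected curve covers the arc: a projection interior to `C` would be `g s` itself,
  -- strictly above the graph, which `hgap` forbids.
  have harc : eVariationOn H.curve (Icc c d) ≤ eVariationOn (fun s => π (g s)) (Icc x y) := by
    refine eVariationOn_le_of_crossing (U := fun s => frameX H.angle (π (g s))) hxy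
      ((continuous_frameX _).comp_continuousOn (dist_continuousOn hlip))
      (by rw [hπx, hx, PolyHalfPlane.frameX_curve]) (by rw [hπy, hy, PolyHalfPlane.frameX_curve])
      (hπx.trans hx) (hπy.trans hy) ?_
    intro s hs hmid
    refine (PolyHalfPlane.curve_frameX (PolyHalfPlane.mem_graph_iff.2 ?_)).symm
    refine le_antisymm (hπ (g s)).1.2 (not_lt.1 fun hlt => ?_)
    have := eq_of_nearest_point_mem_nhds hπ (PolyHalfPlane.mem_nhds_epigraphOver hmid hlt)
    rw [this] at hlt
    exact absurd (hgap s hs) (not_le.2 hlt)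
  have hρ : ∀ s ∈ Icc x y, ρ s = 0 := by
    intro τ hτ
    -- Use the slope inequality with `ρ` growing on `[x, τ]` and shrinking on `[τ, y]`. Since the
    -- projected length is at least `y - x`, adding gives `(1 - m ^ 2) * (y - x) + 4 * m * ρ τ ≤ (1
    -- + m ^ 2) * (y - x)`. Letting `m` tend to `0` then yields `ρ τ = 0`.
    have hbound : ∀ m ∈ Ioo (0 : ℝ) 1, 2 * ρ τ ≤ m * (y - x) := by
      intro m hm
      have hm2 : 0 < 1 - m ^ 2 := by nlinarith [hm.1, hm.2]
      have hstep : ∀ σ : ℝ, |σ| = 1 → ∀ s ∈ Icc x y, ∀ t ∈ Icc x y, s ≤ t →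
          dist (π (g s)) (π (g t)) ≤ ((1 + m ^ 2) * t - 2 * m * (σ * ρ t)) / (1 - m ^ 2) -
            ((1 + m ^ 2) * s - 2 * m * (σ * ρ s)) / (1 - m ^ 2) := by
        intro σ hσ s hs t ht hst
        rw [← sub_div, le_div_iff₀ hm2]
        have h1 := mul_add_mul_le_of_sq_add_sq_le (abs_nonneg (s - t)) (m := m) (hsq s hs t ht)
        rw [abs_sub_comm s t, abs_of_nonneg (sub_nonneg.2 hst)] at h1
        have h2 : σ * (ρ t - ρ s) ≤ |ρ s - ρ t| := by
          rw [abs_sub_comm, ← one_mul |ρ t - ρ s|, ← hσ, ← abs_mul]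
          exact le_abs_self _
        nlinarith [mul_le_mul_of_nonneg_left h2 hm.1.le]
      have hsub1 : Icc x τ ⊆ Icc x y := Icc_subset_Icc_right hτ.2
      have hsub2 : Icc τ y ⊆ Icc x y := Icc_subset_Icc_left hτ.1
      have v1 := eVariationOn_Icc_le_of_dist_le hτ.1 fun s hs t ht hst =>
        hstep 1 (by simp) s (hsub1 hs) t (hsub1 ht) hst
      have v2 := eVariationOn_Icc_le_of_dist_le hτ.2 fun s hs t ht hst =>
        hstep (-1) (by simp) s (hsub2 hs) t (hsub2 ht) hst
      have n1 := dist_nonneg.trans (hstep 1 (by simp) x (hsub1 (left_mem_Icc.2 hτ.1)) τ hτ hτ.1)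
      have n2 := dist_nonneg.trans
        (hstep (-1) (by simp) τ hτ y (hsub2 (right_mem_Icc.2 hτ.2)) hτ.2)
      have s1 := eVariationOn.Icc_add_Icc (fun s => π (g s)) (s := univ) hτ.1 hτ.2 (mem_univ _)
      simp only [univ_inter] at s1
      have hle := (hlen.trans harc).trans (s1.symm.le.trans (add_le_add v1 v2))
      rw [← ENNReal.ofReal_add n1 n2, ENNReal.ofReal_le_ofReal_iff (add_nonneg n1 n2)] at hle
      have rx : ρ x = 0 := by simp [ρ, hπx]
      have ry : ρ y = 0 := by simp [ρ, hπy]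
      rw [rx, ry, ← sub_div, ← sub_div, ← add_div, le_div_iff₀ hm2] at hle
      nlinarith [hm.1]
    have h0 : 0 ≤ ρ τ := norm_nonneg _
    refine le_antisymm (not_lt.1 fun hpos => ?_) h0
    have hyx : 0 ≤ y - x := sub_nonneg.2 hxy
    have h1 : 0 < 1 + (y - x) + ρ τ := by linarith
    have := hbound (ρ τ / (1 + (y - x) + ρ τ))
      ⟨div_pos hpos h1, (div_lt_one h1).2 (by linarith)⟩
    rw [div_mul_eq_mul_div, le_div_iff₀ h1] at this
    nlinarith
  intro s hs
  have hsC : g s ∈ C := by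
    have := (hπ (g s)).1
    rwa [← sub_eq_zero.1 (norm_eq_zero.1 (hρ s hs))] at this
  exact ⟨PolyHalfPlane.mem_graph_iff.2 (le_antisymm hsC.2 (hgap s hs)), hsC.1⟩

/-! ### Convexity and sign of real polynomials. -/

section Polynomial

theorem Polynomial.deriv_two_eval (p : Polynomial ℝ) :
    deriv^[2] (fun w => p.eval w) = fun w => p.derivative.derivative.eval w := by
  have : ∀ q : Polynomial ℝ, deriv (fun w => q.eval w) = fun w => q.derivative.eval w := by
    intro q
    funext w
    simp
  simp [Function.iterate_succ, this]

theorem Polynomial.convexOn_of_derivative_nonneg {p : Polynomial ℝ} {D : Set ℝ} (hD : Convex ℝ D)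
    (h : ∀ w ∈ D, 0 ≤ p.derivative.derivative.eval w) : ConvexOn ℝ D fun w => p.eval w := by
  refine convexOn_of_deriv2_nonneg' hD p.differentiable.differentiableOn ?_ ?_
  · have : deriv (fun w => p.eval w) = fun w => p.derivative.eval w := by
      funext w
      simp
    rw [this]
    exact p.derivative.differentiable.differentiableOn
  · intro w hw
    rw [p.deriv_two_eval]
    exact h w hw

theorem Polynomial.strictConcaveOn_of_derivative_neg {p : Polynomial ℝ} {D : Set ℝ}
    (hD : Convex ℝ D) (h : ∀ w ∈ D, p.derivative.derivative.eval w < 0) :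
    StrictConcaveOn ℝ D fun w => p.eval w := by
  refine strictConcaveOn_of_deriv2_neg' hD p.continuous.continuousOn ?_
  intro w hw
  rw [p.deriv_two_eval]
  exact h w hw

/-- If `2 * K` bounds the second derivative from above, then `K * X ^ 2 - p` is convex. So a chord
exceeds the graph by at most a quadratic error. -/
theorem Polynomial.exists_semiconcave (p : Polynomial ℝ) (u : ℝ) :
    ∃ K : ℝ, 0 ≤ K ∧ ∀ a ∈ Icc (u - 1) (u + 1), ∀ b ∈ Icc (u - 1) (u + 1), ∀ r ∈ Icc (0 : ℝ) 1,
      (1 - r) * p.eval a + r * p.eval b - K * (r * (1 - r)) * (a - b) ^ 2 ≤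
        p.eval ((1 - r) * a + r * b) := by
  obtain ⟨K, hK⟩ := (isCompact_Icc (a := u - 1) (b := u + 1)).bddAbove_image
    (p.derivative.derivative.continuous.continuousOn)
  have hK' : ∀ w ∈ Icc (u - 1) (u + 1), p.derivative.derivative.eval w ≤ 2 * |K| := fun w hw =>
    (hK (mem_image_of_mem _ hw)).trans (by linarith [le_abs_self K, abs_nonneg K])
  refine ⟨|K|, abs_nonneg _, fun a ha b hb r hr => ?_⟩
  have hconv : ConvexOn ℝ (Icc (u - 1) (u + 1))
      fun w => (Polynomial.C |K| * Polynomial.X ^ 2 - p).eval w := by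
    refine Polynomial.convexOn_of_derivative_nonneg (convex_Icc _ _) fun w hw => ?_
    have := hK' w hw
    simp only [Polynomial.derivative_sub, Polynomial.derivative_C_mul, Polynomial.derivative_X_pow]
    simp
    linarith
  have := hconv.2 ha hb (sub_nonneg.2 hr.2) hr.1 (by ring)
  simp only [Polynomial.eval_sub, Polynomial.eval_mul, Polynomial.eval_C, Polynomial.eval_pow,
    Polynomial.eval_X, smul_eq_mul] at this
  nlinarith

/-- A polynomial does not oscillate at `0`: after the power of `r` is factored out, the cofactor has
constant sign near `0`. -/
theorem Polynomial.eventually_nonneg_of_frequently {p : Polynomial ℝ}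
    (h : ∃ᶠ r in 𝓝[>] (0 : ℝ), 0 ≤ p.eval r) : ∀ᶠ r in 𝓝[>] (0 : ℝ), 0 ≤ p.eval r := by
  by_cases hp : p = 0
  · simp [hp]
  set n := p.rootMultiplicity 0
  set q := p /ₘ (Polynomial.X - Polynomial.C 0) ^ n
  have hq : q.eval 0 ≠ 0 := Polynomial.eval_divByMonic_pow_rootMultiplicity_ne_zero 0 hp
  have he : ∀ r, p.eval r = r ^ n * q.eval r := by
    intro r
    conv_lhs => rw [← p.pow_mul_divByMonic_rootMultiplicity_eq 0]
    simp [n, q]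
  have hqc : Tendsto (fun r => q.eval r) (𝓝[>] 0) (𝓝 (q.eval 0)) :=
    (q.continuous.tendsto 0).mono_left nhdsWithin_le_nhds
  rcases hq.lt_or_gt with hneg | hpos
  · obtain ⟨r, h1, h2, h3⟩ := (h.and_eventually
      ((hqc.eventually (Iio_mem_nhds hneg)).and self_mem_nhdsWithin)).exists
    rw [he] at h1
    exact absurd h1 (not_le.2 (mul_neg_of_pos_of_neg (pow_pos h3 _) h2))
  · filter_upwards [hqc.eventually (Ioi_mem_nhds hpos), self_mem_nhdsWithin] with r h2 h3
    rw [he]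
    exact mul_nonneg (pow_nonneg (le_of_lt h3) _) (le_of_lt h2)

theorem Polynomial.exists_affine_of_derivative_derivative_eq_zero {p : Polynomial ℝ}
    (h : p.derivative.derivative = 0) : ∃ α β : ℝ, ∀ w, p.eval w = α + β * w := by
  have h1 := Polynomial.eq_C_of_derivative_eq_zero h
  have h2 : (p - Polynomial.C (p.derivative.coeff 0) * Polynomial.X).derivative = 0 := by
    rw [Polynomial.derivative_sub, Polynomial.derivative_C_mul, Polynomial.derivative_X, mul_one,
      ← h1, sub_self]
  have h3 := Polynomial.eq_C_of_derivative_eq_zero h2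
  refine ⟨(p - Polynomial.C (p.derivative.coeff 0) * Polynomial.X).coeff 0,
    p.derivative.coeff 0, fun w => ?_⟩
  have := congrArg (Polynomial.eval w) h3
  rw [Polynomial.eval_sub, Polynomial.eval_mul, Polynomial.eval_C, Polynomial.eval_X,
    Polynomial.eval_C, sub_eq_iff_eq_add] at this
  exact this

end Polynomial

/-! ### First-order behaviour of constraints; continuous induction. -/

section RightDerivative

variable {φ : ℝ → ℝ} {D : ℝ}

theorem deriv_nonneg_of_eventually_nonneg (h : HasDerivAt φ D 0) (h0 : φ 0 = 0)
    (hn : ∀ᶠ s in 𝓝[>] 0, 0 ≤ φ s) : 0 ≤ D := by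
  refine ge_of_tendsto h.tendsto_slope_zero_right ?_
  filter_upwards [hn, self_mem_nhdsWithin] with s hs hpos
  rw [zero_add, h0, sub_zero, smul_eq_mul]
  exact mul_nonneg (inv_nonneg.2 (le_of_lt hpos)) hs

theorem eventually_half_deriv_mul_le (h : HasDerivAt φ D 0) (h0 : φ 0 = 0) (hD : 0 < D) :
    ∀ᶠ s in 𝓝[>] 0, D / 2 * s ≤ φ s := by
  filter_upwards [h.tendsto_slope_zero_right.eventually (Ioi_mem_nhds (half_lt_self hD)),
    self_mem_nhdsWithin] with s hs hpos
  have hpos' : (0 : ℝ) < s := hpos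
  have hs' : D / 2 < s⁻¹ * φ s := by simpa [h0] using hs
  rw [inv_mul_eq_div, lt_div_iff₀ hpos'] at hs'
  exact hs'.le

end RightDerivative

namespace PolyHalfPlane

theorem gap_lineMap (H : PolyHalfPlane) (p q : Plane) (r : ℝ) :
    H.gap (AffineMap.lineMap p q r) =
      H.poly.eval ((1 - r) * frameX H.angle p + r * frameX H.angle q) -
        ((1 - r) * frameY H.angle p + r * frameY H.angle q) := by
  rw [gap, frameX_lineMap, frameY_lineMap]

/-- Makes the sign of one constraint along another graph accessible to
`Polynomial.eventually_nonneg_of_frequently`. -/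
theorem exists_polynomial_gap_curve (H G : PolyHalfPlane) (u σ : ℝ) :
    ∃ p : Polynomial ℝ, ∀ r, p.eval r = G.gap (H.curve (u + σ * r)) := by
  let V : Polynomial ℝ := H.poly.comp (Polynomial.C u + Polynomial.C σ * Polynomial.X)
  let U : Polynomial ℝ := Polynomial.C u + Polynomial.C σ * Polynomial.X
  let x0 : Polynomial ℝ := Polynomial.C (Real.cos H.angle) * U - Polynomial.C (Real.sin H.angle) * V
  let x1 : Polynomial ℝ := Polynomial.C (Real.sin H.angle) * U + Polynomial.C (Real.cos H.angle) * V
  refine ⟨G.poly.comp (Polynomial.C (Real.cos G.angle) * x0 + Polynomial.C (Real.sin G.angle) * x1)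
    - (-Polynomial.C (Real.sin G.angle) * x0 + Polynomial.C (Real.cos G.angle) * x1), fun r => ?_⟩
  simp [gap, curve, framePoint, frameX, frameY, x0, x1, U, V]

theorem hasDerivAt_gap_line (H : PolyHalfPlane) (p e : Plane) :
    HasDerivAt (fun s : ℝ => H.gap (p + s • e))
      (H.poly.derivative.eval (frameX H.angle p) * frameX H.angle e - frameY H.angle e) 0 := by
  have h1 : HasDerivAt (fun s : ℝ => frameX H.angle p + s * frameX H.angle e)
      (frameX H.angle e) 0 := by
    simpa using ((hasDerivAt_id (0 : ℝ)).mul_const (frameX H.angle e)).const_add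
      (frameX H.angle p)
  have h2 : HasDerivAt (fun s : ℝ => frameY H.angle p + s * frameY H.angle e)
      (frameY H.angle e) 0 := by
    simpa using ((hasDerivAt_id (0 : ℝ)).mul_const (frameY H.angle e)).const_add
      (frameY H.angle p)
  have h3 := (H.poly.hasDerivAt (frameX H.angle p + 0 * frameX H.angle e)).comp (0 : ℝ) h1
  simp only [zero_mul, add_zero] at h3
  refine (h3.sub h2).congr_of_eventuallyEq (Eventually.of_forall fun s => ?_)
  simp [gap, frameX_add, frameY_add, frameX_smul, frameY_smul]

end PolyHalfPlane

/-- Unit vectors of the same slope agree up to sign. -/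
theorem eq_or_eq_neg_of_frame_slope {θ κ : ℝ} {e f : Plane} (he : ‖e‖ = 1) (hf : ‖f‖ = 1)
    (h1 : κ * frameX θ e - frameY θ e = 0) (h2 : κ * frameX θ f - frameY θ f = 0) :
    e = f ∨ e = -f := by
  have n1 := norm_sq_eq_frame θ e
  have n2 := norm_sq_eq_frame θ f
  rw [he, ← sub_eq_zero.1 h1] at n1
  rw [hf, ← sub_eq_zero.1 h2] at n2
  have hsq : frameX θ e ^ 2 = frameX θ f ^ 2 := by
    have hpos : 0 < 1 + κ ^ 2 := by positivity
    apply mul_left_cancel₀ hpos.ne'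
    linarith
  rcases sq_eq_sq_iff_eq_or_eq_neg.1 hsq with h | h
  · exact Or.inl (frame_ext θ h (by rw [← sub_eq_zero.1 h1, ← sub_eq_zero.1 h2, h]))
  · right
    have hx : frameX θ (-f) = -frameX θ f := by simpa using frameX_smul θ (-1) f
    have hy : frameY θ (-f) = -frameY θ f := by simpa using frameY_smul θ (-1) f
    exact frame_ext θ (by rw [hx, h]) (by rw [hy, ← sub_eq_zero.1 h1, ← sub_eq_zero.1 h2, h]; ring)

/-- An argument by continuous induction along an interval. -/
theorem Icc_induction {R : ℝ → Prop} {x y : ℝ} (hxy : x ≤ y) (h0 : R x)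
    (hright : ∀ t ∈ Ico x y, R t → ∃ t' ∈ Ioc t y, R t')
    (hleft : ∀ t ∈ Ioc x y, ∃ t' < t, ∀ s ∈ Ico x t, t' < s → R s → R t) : R y := by
  set S : Set ℝ := {t | t ∈ Icc x y ∧ R t} with hS
  have hxS : x ∈ S := ⟨⟨le_rfl, hxy⟩, h0⟩
  have hbdd : BddAbove S := ⟨y, fun t ht => ht.1.2⟩
  set c := sSup S with hc
  have hxc : x ≤ c := le_csSup hbdd hxS
  have hcy : c ≤ y := csSup_le ⟨x, hxS⟩ fun t ht => ht.1.2
  have hcR : R c := by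
    rcases hxc.eq_or_lt with h | h
    · rwa [← h]
    obtain ⟨t', ht', H⟩ := hleft c ⟨h, hcy⟩
    obtain ⟨s, hs, hts⟩ := exists_lt_of_lt_csSup ⟨x, hxS⟩ ht'
    rcases (le_csSup hbdd hs).eq_or_lt with hsc | hsc
    · rw [hc, ← hsc]; exact hs.2
    · exact H s ⟨hs.1.1, hsc⟩ hts hs.2
  rcases hcy.eq_or_lt with h | h
  · rwa [← h]
  · obtain ⟨t', ht', hR⟩ := hright c ⟨hxc, h⟩ hcR
    exact absurd (le_csSup hbdd ⟨⟨hxc.trans ht'.1.le, ht'.2⟩, hR⟩) (not_le.2 ht'.1)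

/-! ### Taut curves: chords, concave contacts and corners. -/

/-- A curve of unit speed is straight on `[x, y]`. -/
def IsStraightOn (g : ℝ → Plane) (x y : ℝ) : Prop := dist (g x) (g y) = y - x

theorem lineMap_mem_ball {P p q : Plane} {ε r : ℝ} (hp : dist p P < ε) (hq : dist q P < ε)
    (hr : r ∈ Icc (0 : ℝ) 1) : dist (AffineMap.lineMap p q r) P < ε :=
  (convex_ball P ε).lineMap_mem (Metric.mem_ball.2 hp) (Metric.mem_ball.2 hq) hr

namespace IsTaut

variable {k : ℕ} {H : Fin k → PolyHalfPlane} {g : ℝ → Plane} {L : ℝ}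

theorem reverse (h : IsTaut H g L) : IsTaut H (fun s => g (L - s)) L := by
  have hm : ∀ s ∈ Icc 0 L, L - s ∈ Icc 0 L := fun s hs =>
    ⟨sub_nonneg.2 hs.2, sub_le_self _ hs.1⟩
  have he : ∀ s t : ℝ, |(L - s) - (L - t)| = |s - t| := fun s t => by
    rw [sub_sub_sub_cancel_left, abs_sub_comm]
  refine ⟨fun s hs => h.gap_nonneg _ (hm s hs), fun s hs t ht => ?_, fun s hs t ht => ?_,
    fun s hs t ht => ?_⟩
  · rw [← he]; exact h.dist_le _ (hm s hs) _ (hm t ht)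
  · rw [← he]; exact h.le_dist _ (hm s hs) _ (hm t ht)
  · rw [← he]; exact h.le_eVariationOn _ (hm s hs) _ (hm t ht)

/-- If two times give the same point, the constant chord is admissible and bounds the time
difference by zero. -/
theorem injOn (h : IsTaut H g L) : InjOn g (Icc 0 L) := by
  intro s hs t ht hst
  have := h.le_dist s hs t ht fun r _ i => by
    rw [← hst, AffineMap.lineMap_same_apply]
    exact h.gap_nonneg s hs i
  rw [hst, dist_self] at this
  exact sub_eq_zero.1 (abs_nonpos_iff.1 this)

theorem continuousOn (h : IsTaut H g L) : ContinuousOn g (Icc 0 L) := dist_continuousOn h.dist_le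

theorem dist_le_sub (h : IsTaut H g L) {x y : ℝ} (hx : 0 ≤ x) (hxy : x ≤ y) (hy : y ≤ L) :
    dist (g x) (g y) ≤ y - x := by
  have := h.dist_le x ⟨hx, hxy.trans hy⟩ y ⟨hx.trans hxy, hy⟩
  rwa [abs_sub_comm, abs_of_nonneg (sub_nonneg.2 hxy)] at this

/-- Equality over `[x, y]` forces equality in each of the unit-speed bounds that the triangle
inequality adds up. -/
theorem straight_mono (h : IsTaut H g L) {x y x' y' : ℝ} (hx : 0 ≤ x) (hy : y ≤ L)
    (hs : IsStraightOn g x y) (h1 : x ≤ x') (h2 : x' ≤ y') (h3 : y' ≤ y) :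
    IsStraightOn g x' y' := by
  have d1 := h.dist_le_sub hx h1 (h2.trans (h3.trans hy))
  have d2 := h.dist_le_sub (hx.trans h1) h2 (h3.trans hy)
  have d3 := h.dist_le_sub ((hx.trans h1).trans h2) h3 hy
  have t1 := dist_triangle (g x) (g x') (g y)
  have t2 := dist_triangle (g x') (g y') (g y)
  unfold IsStraightOn at *
  linarith

theorem eq_lineMap (h : IsTaut H g L) {x y s : ℝ} (hx : 0 ≤ x) (hxy : x < y) (hy : y ≤ L)
    (hst : IsStraightOn g x y) (hs : s ∈ Icc x y) :
    g s = AffineMap.lineMap (g x) (g y) ((s - x) / (y - x)) := by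
  have hpos : 0 < y - x := sub_pos.2 hxy
  have d1 : dist (g x) (g s) = s - x := h.straight_mono hx hy hst le_rfl hs.1 hs.2
  have d2 : dist (g s) (g y) = y - s := h.straight_mono hx hy hst hs.1 hs.2 le_rfl
  have d3 : dist (g x) (g y) = y - x := hst
  apply eq_lineMap_of_dist_eq_mul_of_dist_eq_mul
  · rw [d1, d3, div_mul_cancel₀ _ hpos.ne']
  · rw [d2, d3, sub_mul, div_mul_cancel₀ _ hpos.ne']; ring

/-- The chord over a symmetric time interval around `t` does not cross slack constraints. -/
theorem eventually_chord_of_gap_pos (h : IsTaut H g L) {t : ℝ} (ht : t ∈ Ioo 0 L) {i : Fin k}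
    (hi : 0 < (H i).gap (g t)) : ∀ᶠ s in 𝓝[>] (0 : ℝ), ∀ r ∈ Icc (0 : ℝ) 1,
      0 ≤ (H i).gap (AffineMap.lineMap (g (t - s)) (g (t + s)) r) := by
  obtain ⟨ε, hε, hb⟩ := Metric.mem_nhds_iff.1
    ((H i).continuous_gap.continuousAt.preimage_mem_nhds (Ioi_mem_nhds hi))
  filter_upwards [Ioo_mem_nhdsGT hε, Ioo_mem_nhdsGT ht.1, Ioo_mem_nhdsGT (sub_pos.2 ht.2)]
    with s hs h1 h2 r hr
  have d1 := h.dist_le_sub (x := t - s) (y := t) (by linarith [h1.2]) (by linarith [hs.1]) ht.2.le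
  have d2 := h.dist_le_sub (x := t) (y := t + s) ht.1.le (by linarith [hs.1]) (by linarith [h2.2])
  rw [dist_comm] at d2
  have : AffineMap.lineMap (g (t - s)) (g (t + s)) r ∈ Metric.ball (g t) ε :=
    lineMap_mem_ball (by linarith [hs.2]) (by linarith [hs.2]) hr
  exact le_of_lt (hb this)

theorem eventually_dist_eq_of_chord (h : IsTaut H g L) {t : ℝ} (ht : t ∈ Ioo 0 L)
    (hc : ∀ i, ∀ᶠ s in 𝓝[>] (0 : ℝ), ∀ r ∈ Icc (0 : ℝ) 1,
      0 ≤ (H i).gap (AffineMap.lineMap (g (t - s)) (g (t + s)) r)) :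
    ∀ᶠ s in 𝓝[>] (0 : ℝ), IsStraightOn g (t - s) (t + s) := by
  filter_upwards [eventually_all.2 hc, Ioo_mem_nhdsGT ht.1, Ioo_mem_nhdsGT (sub_pos.2 ht.2)]
    with s hs h1 h2
  have m1 : t - s ∈ Icc 0 L := ⟨by linarith [h1.2], by linarith [h1.1, ht.2]⟩
  have m2 : t + s ∈ Icc 0 L := ⟨by linarith [h1.1, ht.1], by linarith [h2.2]⟩
  have e := h.le_dist _ m1 _ m2 fun r hr i => hs i r hr
  rw [abs_sub_comm, abs_of_nonneg (by linarith [h1.1])] at e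
  exact le_antisymm (h.dist_le_sub m1.1 (by linarith [h1.1]) m2.2) e

/-- A taut curve does not bend where it touches only strictly concave bounding graphs, so it cannot
touch them at all at interior times. -/
theorem false_of_concave_contact (h : IsTaut H g L) {t : ℝ} (ht : t ∈ Ioo 0 L)
    (hneg : ∀ i, (H i).gap (g t) = 0 →
      (H i).poly.derivative.derivative.eval (frameX (H i).angle (g t)) < 0)
    {i : Fin k} (hi : (H i).gap (g t) = 0) : False := by
  have hconc : ∀ i, (H i).gap (g t) = 0 → ∃ ε > 0,
      StrictConcaveOn ℝ (Metric.ball (frameX (H i).angle (g t)) ε)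
        fun w => (H i).poly.eval w := by
    intro i hi
    obtain ⟨ε, hε, hb⟩ := Metric.mem_nhds_iff.1
      ((H i).poly.derivative.derivative.continuous.continuousAt.preimage_mem_nhds
        (Iio_mem_nhds (hneg i hi)))
    exact ⟨ε, hε, Polynomial.strictConcaveOn_of_derivative_neg (convex_ball _ _) fun w hw => hb hw⟩
  have hball : ∀ i, ∀ ε > 0, ∀ᶠ s in 𝓝[>] (0 : ℝ),
      frameX (H i).angle (g (t - s)) ∈ Metric.ball (frameX (H i).angle (g t)) ε ∧
      frameX (H i).angle (g (t + s)) ∈ Metric.ball (frameX (H i).angle (g t)) ε ∧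
      t - s ∈ Icc 0 L ∧ t + s ∈ Icc 0 L := by
    intro i ε hε
    filter_upwards [Ioo_mem_nhdsGT hε, Ioo_mem_nhdsGT ht.1, Ioo_mem_nhdsGT (sub_pos.2 ht.2)]
      with s hs h1 h2
    have d1 := h.dist_le_sub (x := t - s) (y := t) (by linarith [h1.2]) (by linarith [hs.1]) ht.2.le
    have d2 := h.dist_le_sub (x := t) (y := t + s) ht.1.le (by linarith [hs.1]) (by linarith [h2.2])
    rw [dist_comm] at d2
    refine ⟨?_, ?_, ⟨by linarith [h1.2], by linarith [h1.1, ht.2]⟩,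
      ⟨by linarith [h1.1, ht.1], by linarith [h2.2]⟩⟩
    · rw [Metric.mem_ball, Real.dist_eq]
      exact (abs_frameX_sub_le _ _ _).trans_lt (by linarith [hs.2])
    · rw [Metric.mem_ball, Real.dist_eq]
      exact (abs_frameX_sub_le _ _ _).trans_lt (by linarith [hs.2])
  -- Touching constraints are concave near the contact, so chords between admissible points respect
  -- them; the other constraints are slack.
  have hstraight := h.eventually_dist_eq_of_chord ht fun i => by
    rcases (h.gap_nonneg t (Ioo_subset_Icc_self ht) i).eq_or_lt with h0 | h0
    · obtain ⟨ε, hε, hε'⟩ := hconc i h0.symm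
      filter_upwards [hball i ε hε] with s ⟨b1, b2, m1, m2⟩ r hr
      have := hε'.concaveOn.2 b1 b2 (sub_nonneg.2 hr.2) hr.1 (by ring)
      have g1 := h.gap_nonneg _ m1 i
      have g2 := h.gap_nonneg _ m2 i
      rw [PolyHalfPlane.gap_lineMap]
      simp only [PolyHalfPlane.gap, smul_eq_mul] at this g1 g2
      nlinarith [mul_nonneg (sub_nonneg.2 hr.2) g1, mul_nonneg hr.1 g2]
    · exact h.eventually_chord_of_gap_pos ht h0
  obtain ⟨ε, hε, hε'⟩ := hconc i hi
  obtain ⟨s, hs, ⟨b1, b2, m1, m2⟩, hpos⟩ :=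
    (hstraight.and ((hball i ε hε).and self_mem_nhdsWithin)).exists
  have hpos' : (0 : ℝ) < s := hpos
  have hmid := h.eq_lineMap m1.1 (by linarith) m2.2 hs (s := t) ⟨by linarith, by linarith⟩
  rw [show (t - (t - s)) / (t + s - (t - s)) = 1 / 2 by
    rw [div_eq_div_iff (by linarith) (by norm_num)]; ring] at hmid
  rw [hmid, PolyHalfPlane.gap_lineMap] at hi
  have g1 := h.gap_nonneg _ m1 i
  have g2 := h.gap_nonneg _ m2 i
  have hne : g (t - s) ≠ g (t + s) := fun he => by
    have := h.injOn m1 m2 he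
    linarith
  simp only [PolyHalfPlane.gap] at g1 g2
  -- Now `g t` is the midpoint of a chord. A chord vertical in the frame would have both ends on the
  -- graph at the same abscissa, contradicting injectivity; otherwise strict concavity makes the gap
  -- at the midpoint positive.
  by_cases hu : frameX (H i).angle (g (t - s)) = frameX (H i).angle (g (t + s))
  · rw [hu] at hi g1
    rw [show (1 - 1 / 2) * frameX (H i).angle (g (t + s)) + 1 / 2 * frameX (H i).angle (g (t + s))
      = frameX (H i).angle (g (t + s)) by ring] at hi
    exact hne (frame_ext _ hu (by linarith))
  · have := hε'.2 b1 b2 hu (by norm_num : (0 : ℝ) < 1 - 1 / 2)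
      (by norm_num : (0 : ℝ) < 1 / 2) (by norm_num)
    simp only [smul_eq_mul] at this
    linarith

/-- At an active constraint that opens linearly in at least one of two directions, short chords
between the two directions respect the constraint. -/
theorem eventually_chord_of_opening (h : IsTaut H g L) {t : ℝ} (ht : t ∈ Ioo 0 L) {i : Fin k}
    {c : ℝ} (hc : 0 < c) (hopen : ∀ᶠ s in 𝓝[>] (0 : ℝ),
      c * s ≤ (H i).gap (g (t - s)) ∨ c * s ≤ (H i).gap (g (t + s))) :
    ∀ᶠ s in 𝓝[>] (0 : ℝ), ∀ r ∈ Icc (0 : ℝ) 1,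
      0 ≤ (H i).gap (AffineMap.lineMap (g (t - s)) (g (t + s)) r) := by
  obtain ⟨K, hK0, hK⟩ := (H i).poly.exists_semiconcave (frameX (H i).angle (g t))
  -- For `s` below this threshold, `K * (2 * s) ^ 2 ≤ c * s`, so the linear opening absorbs the
  -- semiconcavity error. The `+ 1` covers `K = 0`.
  have hKc : 0 < c / (4 * K + 1) := by positivity
  filter_upwards [hopen, Ioo_mem_nhdsGT ht.1, Ioo_mem_nhdsGT (sub_pos.2 ht.2),
    Ioo_mem_nhdsGT one_pos, Ioo_mem_nhdsGT hKc] with s hs h1 h2 h3 h4 r hr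
  have hs0 : 0 < s := h1.1
  have m1 : t - s ∈ Icc 0 L := ⟨by linarith [h1.2], by linarith [h1.1, ht.2]⟩
  have m2 : t + s ∈ Icc 0 L := ⟨by linarith [h1.1, ht.1], by linarith [h2.2]⟩
  have d1 := h.dist_le_sub m1.1 (y := t) (by linarith [h1.1]) ht.2.le
  have d2 := h.dist_le_sub ht.1.le (y := t + s) (by linarith [h1.1]) m2.2
  have d3 := h.dist_le_sub m1.1 (y := t + s) (by linarith [h1.1]) m2.2
  rw [dist_comm] at d2
  have a1 := abs_le.1 ((abs_frameX_sub_le (H i).angle _ _).trans d1)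
  have a2 := abs_le.1 ((abs_frameX_sub_le (H i).angle _ _).trans d2)
  have a3 := sq_le_sq' (by linarith [(abs_le.1 ((abs_frameX_sub_le (H i).angle _ _).trans d3)).1])
    ((abs_le.1 ((abs_frameX_sub_le (H i).angle _ _).trans d3)).2)
  have key := hK _ (show frameX (H i).angle (g (t - s)) ∈ _ from
      ⟨by linarith [h3.2], by linarith [h3.2]⟩) _ (show frameX (H i).angle (g (t + s)) ∈ _ from
      ⟨by linarith [h3.2], by linarith [h3.2]⟩) r hr
  have g1 := h.gap_nonneg _ m1 i
  have g2 := h.gap_nonneg _ m2 i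
  rw [PolyHalfPlane.gap_lineMap]
  have hrr : 0 ≤ r * (1 - r) := mul_nonneg hr.1 (sub_nonneg.2 hr.2)
  have hK4 : 4 * K * s ≤ c := by
    have := (lt_div_iff₀ (by positivity)).1 h4.2
    nlinarith
  have err : K * (r * (1 - r)) *
      (frameX (H i).angle (g (t - s)) - frameX (H i).angle (g (t + s))) ^ 2 ≤
      r * (1 - r) * (c * s) := by
    have e1 := mul_le_mul_of_nonneg_left a3 (mul_nonneg hK0 hrr)
    have e2 := mul_le_mul_of_nonneg_left (mul_le_mul_of_nonneg_right hK4 hs0.le) hrr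
    nlinarith
  have hcs : 0 ≤ c * s := by positivity
  have main : r * (1 - r) * (c * s) ≤
      (1 - r) * (H i).gap (g (t - s)) + r * (H i).gap (g (t + s)) := by
    have hr1 := sub_nonneg.2 hr.2
    rcases hs with hs | hs
    · have e1 : r * (1 - r) * (c * s) ≤ (1 - r) * (c * s) :=
        mul_le_mul_of_nonneg_right (by nlinarith [hr.2]) hcs
      nlinarith [mul_le_mul_of_nonneg_left hs hr1, mul_nonneg hr.1 g2]
    · have e1 : r * (1 - r) * (c * s) ≤ r * (c * s) :=
        mul_le_mul_of_nonneg_right (by nlinarith [hr.1]) hcs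
      nlinarith [mul_le_mul_of_nonneg_left hs hr.1, mul_nonneg hr1 g1]
  simp only [PolyHalfPlane.gap] at main
  linarith

/-- A corner could be cut. Let `e` and `f` be the unit directions from `g y` back to `g x` and on to
`g z`; injectivity excludes `e = f`. Unless `e = -f`, no active graph is tangent to both, so each
active constraint opens linearly along `e` or `f`. Short chords are then admissible and `g` is
straight near `y`, whence `e = -f` after all. -/
theorem straight_trans (h : IsTaut H g L) {x y z : ℝ} (hx : 0 ≤ x) (hz : z ≤ L) (hxy : x ≤ y)
    (hyz : y ≤ z) (h1 : IsStraightOn g x y) (h2 : IsStraightOn g y z) : IsStraightOn g x z := by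
  rcases hxy.eq_or_lt with rfl | hxy
  · exact h2
  rcases hyz.eq_or_lt with rfl | hyz
  · exact h1
  have hyI : y ∈ Ioo 0 L := ⟨by linarith, by linarith⟩
  have p1 : 0 < y - x := sub_pos.2 hxy
  have p2 : 0 < z - y := sub_pos.2 hyz
  set e : Plane := (y - x)⁻¹ • (g x - g y) with he
  set f : Plane := (z - y)⁻¹ • (g z - g y) with hf
  have ne : ‖e‖ = 1 := by
    rw [he, norm_smul, ← dist_eq_norm, h1, norm_inv, Real.norm_of_nonneg p1.le,
      inv_mul_cancel₀ p1.ne']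
  have nf : ‖f‖ = 1 := by
    rw [hf, norm_smul, ← dist_eq_norm, dist_comm, h2, norm_inv, Real.norm_of_nonneg p2.le,
      inv_mul_cancel₀ p2.ne']
  have ge : ∀ s ∈ Icc 0 (y - x), g (y - s) = g y + s • e := by
    intro s hs
    rw [h.eq_lineMap hx hxy (by linarith) h1 (s := y - s) ⟨by linarith [hs.2], by linarith [hs.1]⟩,
      AffineMap.lineMap_apply_module', he, smul_smul,
      show (y - s - x) / (y - x) = 1 - s * (y - x)⁻¹ by field_simp; ring]
    module
  have gf : ∀ s ∈ Icc 0 (z - y), g (y + s) = g y + s • f := by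
    intro s hs
    rw [h.eq_lineMap (by linarith) hyz hz h2 (s := y + s) ⟨by linarith [hs.1], by linarith [hs.2]⟩,
      AffineMap.lineMap_apply_module', hf, smul_smul,
      show (y + s - y) / (z - y) = s * (z - y)⁻¹ by field_simp; ring]
    module
  have small : ∀ᶠ s in 𝓝[>] (0 : ℝ), s ∈ Icc 0 (y - x) ∧ s ∈ Icc 0 (z - y) ∧ 0 < s := by
    filter_upwards [Ioo_mem_nhdsGT p1, Ioo_mem_nhdsGT p2] with s s1 s2
    exact ⟨Ioo_subset_Icc_self s1, Ioo_subset_Icc_self s2, s1.1⟩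
  have hne : e ≠ f := by
    intro hef
    obtain ⟨s, s1, s2, s3⟩ := small.exists
    have := h.injOn (⟨by linarith [s1.2], by linarith [s1.1]⟩ : y - s ∈ Icc 0 L)
      (⟨by linarith [s1.1], by linarith [s2.2]⟩ : y + s ∈ Icc 0 L) (by rw [ge s s1, gf s s2, hef])
    linarith
  by_cases hopp : e = -f
  · have hgx := ge (y - x) ⟨p1.le, le_rfl⟩
    have hgz := gf (z - y) ⟨p2.le, le_rfl⟩
    rw [sub_sub_cancel] at hgx
    rw [add_sub_cancel] at hgz
    unfold IsStraightOn
    rw [hgx, hgz, hopp, dist_add_left, dist_eq_norm, smul_neg, ← neg_add', norm_neg, ← add_smul,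
      norm_smul, nf, Real.norm_of_nonneg (by linarith)]
    ring
  exfalso
  have hchord := h.eventually_dist_eq_of_chord hyI fun i => by
    rcases (h.gap_nonneg y (Ioo_subset_Icc_self hyI) i).eq_or_lt with h0 | h0
    · have de := (H i).hasDerivAt_gap_line (g y) e
      have df := (H i).hasDerivAt_gap_line (g y) f
      have ze : (H i).gap (g y + (0 : ℝ) • e) = 0 := by simp [← h0]
      have zf : (H i).gap (g y + (0 : ℝ) • f) = 0 := by simp [← h0]
      have De := deriv_nonneg_of_eventually_nonneg de ze (by
        filter_upwards [small] with s ⟨s1, _, _⟩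
        rw [← ge s s1]
        exact h.gap_nonneg _ ⟨by linarith [s1.2], by linarith [s1.1]⟩ i)
      have Df := deriv_nonneg_of_eventually_nonneg df zf (by
        filter_upwards [small] with s ⟨_, s2, _⟩
        rw [← gf s s2]
        exact h.gap_nonneg _ ⟨by linarith [s2.1], by linarith [s2.2]⟩ i)
      rcases De.eq_or_lt with De | De
      · rcases Df.eq_or_lt with Df | Df
        · rcases eq_or_eq_neg_of_frame_slope ne nf De.symm Df.symm with hh | hh
          · exact absurd hh hne
          · exact absurd hh hopp
        · refine h.eventually_chord_of_opening hyI (half_pos Df) ?_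
          filter_upwards [small, eventually_half_deriv_mul_le df zf Df] with s ⟨_, s2, _⟩ hs
          right
          rw [gf s s2]
          exact hs
      · refine h.eventually_chord_of_opening hyI (half_pos De) ?_
        filter_upwards [small, eventually_half_deriv_mul_le de ze De] with s ⟨s1, _, _⟩ hs
        left
        rw [ge s s1]
        exact hs
    · exact h.eventually_chord_of_gap_pos hyI h0
  obtain ⟨s, hs, s1, s2, s3⟩ := (hchord.and small).exists
  unfold IsStraightOn at hs
  rw [ge s s1, gf s s2, dist_add_left, dist_eq_norm, ← smul_sub, norm_smul,
    Real.norm_of_nonneg s3.le] at hs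
  have hnorm : ‖e + -f‖ = ‖e‖ + ‖-f‖ := by
    rw [norm_neg, ne, nf, ← sub_eq_add_neg]
    apply mul_left_cancel₀ s3.ne'
    linarith
  have hray := sameRay_iff_norm_add.2 hnorm
  exact hopp ((sameRay_iff_of_norm_eq (by rw [norm_neg, ne, nf])).1 hray)

end IsTaut

/-! ### Local structure: a segment or a convex arc on each side of a time. -/

/-- On `[x, y]` the curve `g` runs on the graph of `H`, where this is convex upward and not a
straight line. -/
def IsArcOn (H : PolyHalfPlane) (g : ℝ → Plane) (x y : ℝ) : Prop :=
  H.poly.derivative.derivative ≠ 0 ∧ ∀ s ∈ Icc x y,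
    g s ∈ H.graph ∧ 0 ≤ H.poly.derivative.derivative.eval (frameX H.angle (g s))

theorem IsArcOn.mono {H : PolyHalfPlane} {g : ℝ → Plane} {x y x' y' : ℝ} (h : IsArcOn H g x y)
    (hx : x ≤ x') (hy : y' ≤ y) : IsArcOn H g x' y' :=
  ⟨h.1, fun s hs => h.2 s ⟨hx.trans hs.1, hs.2.trans hy⟩⟩

theorem IsArcOn.trans {H : PolyHalfPlane} {g : ℝ → Plane} {x y z : ℝ} (h : IsArcOn H g x y)
    (h' : IsArcOn H g y z) : IsArcOn H g x z :=
  ⟨h.1, fun s hs => (le_total s y).elim (fun hsy => h.2 s ⟨hs.1, hsy⟩)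
    fun hys => h'.2 s ⟨hys, hs.2⟩⟩

namespace IsTaut

variable {k : ℕ} {H : Fin k → PolyHalfPlane} {g : ℝ → Plane} {L : ℝ}

theorem exists_straight_nhds (h : IsTaut H g L) {t : ℝ} (ht : t ∈ Icc 0 L)
    (hpos : ∀ i, 0 < (H i).gap (g t)) : ∃ ε > 0, ∀ x y, 0 ≤ x → x ≤ y → y ≤ L → t - ε < x →
      y < t + ε → IsStraightOn g x y := by
  have hev : ∀ᶠ p in 𝓝 (g t), ∀ i, 0 < (H i).gap p :=
    eventually_all.2 fun i => (H i).continuous_gap.continuousAt.eventually (Ioi_mem_nhds (hpos i))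
  obtain ⟨ε, hε, hb⟩ := Metric.eventually_nhds_iff.1 hev
  refine ⟨ε, hε, fun x y hx hxy hy h1 h2 => ?_⟩
  have hx' : x ∈ Icc 0 L := ⟨hx, hxy.trans hy⟩
  have hy' : y ∈ Icc 0 L := ⟨hx.trans hxy, hy⟩
  have d1 : dist (g x) (g t) < ε := (h.dist_le x hx' t ht).trans_lt
    (abs_lt.2 ⟨by linarith, by linarith⟩)
  have d2 : dist (g y) (g t) < ε := (h.dist_le y hy' t ht).trans_lt
    (abs_lt.2 ⟨by linarith, by linarith⟩)
  have := h.le_dist x hx' y hy' fun r hr i => (hb (lineMap_mem_ball d1 d2 hr) i).le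
  rw [abs_sub_comm, abs_of_nonneg (sub_nonneg.2 hxy)] at this
  exact le_antisymm (h.dist_le_sub hx hxy hy) this

theorem straight_of_no_contact (h : IsTaut H g L) {p q : ℝ} (hp : 0 ≤ p) (hpq : p ≤ q)
    (hq : q ≤ L) (hpos : ∀ t ∈ Ioo p q, ∀ i, 0 < (H i).gap (g t)) : IsStraightOn g p q := by
  have hin : ∀ x y, p < x → x ≤ y → y < q → IsStraightOn g x y := by
    intro x y hx hxy hy
    refine Icc_induction (R := fun t => IsStraightOn g x t) hxy
      (by simp [IsStraightOn]) ?_ ?_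
    · intro t ht hR
      obtain ⟨ε, hε, H'⟩ := h.exists_straight_nhds (t := t)
        ⟨by linarith [ht.1], by linarith [ht.2]⟩ (hpos t ⟨by linarith [ht.1], by linarith [ht.2]⟩)
      have hm : min y (t + ε / 2) ≤ y := min_le_left _ _
      have hm2 : min y (t + ε / 2) ≤ t + ε / 2 := min_le_right _ _
      have hlt : t < min y (t + ε / 2) := lt_min ht.2 (by linarith)
      refine ⟨min y (t + ε / 2), ⟨hlt, hm⟩, ?_⟩
      exact h.straight_trans (by linarith) (by linarith) ht.1 hlt.le hR
        (H' _ _ (by linarith [ht.1]) hlt.le (by linarith) (by linarith) (by linarith))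
    · intro t ht
      obtain ⟨ε, hε, H'⟩ := h.exists_straight_nhds (t := t)
        ⟨by linarith [ht.1], by linarith [ht.2]⟩ (hpos t ⟨by linarith [ht.1], by linarith [ht.2]⟩)
      refine ⟨t - ε, by linarith, fun s hs hs' hR => ?_⟩
      exact h.straight_trans (by linarith) (by linarith [ht.2]) hs.1 hs.2.le hR
        (H' _ _ (by linarith [hs.1]) hs.2.le (by linarith [ht.2]) (by linarith) (by linarith))
  rcases hpq.eq_or_lt with rfl | hlt
  · simp [IsStraightOn]
  -- The end points may be contacts, so they are reached by a limit: shrinking by `η` at both ends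
  -- costs at most `4 * η ≤ ε`.
  refine le_antisymm (h.dist_le_sub hp hpq hq) (le_of_forall_pos_le_add fun ε hε => ?_)
  set η := min (ε / 4) ((q - p) / 4)
  have hη : 0 < η := lt_min (by linarith) (by linarith)
  have hη1 : η ≤ ε / 4 := min_le_left _ _
  have hη2 : η ≤ (q - p) / 4 := min_le_right _ _
  have e := hin (p + η) (q - η) (by linarith) (by linarith) (by linarith)
  have d1 := h.dist_le_sub hp (y := p + η) (by linarith) (by linarith)
  have d2 := h.dist_le_sub (x := q - η) (y := q) (by linarith) (by linarith) hq
  have t1 := dist_triangle (g (p + η)) (g p) (g (q - η))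
  have t2 := dist_triangle (g p) (g q) (g (q - η))
  rw [dist_comm (g (p + η)) (g p)] at t1
  rw [dist_comm (g q)] at t2
  unfold IsStraightOn at e
  linarith

/-- When the polynomial is affine, the admissible arc is the chord; otherwise the length comparison
with a convex arc applies, after time reversal if the arc runs leftward. -/
theorem straight_or_arc_of_arc_mem (h : IsTaut H g L) {x y : ℝ} (hx : 0 ≤ x) (hxy : x ≤ y)
    (hy : y ≤ L) {i : Fin k} (hgx : g x ∈ (H i).graph) (hgy : g y ∈ (H i).graph)
    (harc : ∀ w ∈ uIcc (frameX (H i).angle (g x)) (frameX (H i).angle (g y)),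
      (∀ j, 0 ≤ (H j).gap ((H i).curve w)) ∧ 0 ≤ (H i).poly.derivative.derivative.eval w) :
    IsStraightOn g x y ∨ IsArcOn (H i) g x y := by
  have hx' : x ∈ Icc 0 L := ⟨hx, hxy.trans hy⟩
  have hy' : y ∈ Icc 0 L := ⟨hx.trans hxy, hy⟩
  by_cases h0 : (H i).poly.derivative.derivative = 0
  · left
    obtain ⟨α, β, hαβ⟩ := Polynomial.exists_affine_of_derivative_derivative_eq_zero h0
    have hseg : ∀ r : ℝ, AffineMap.lineMap (g x) (g y) r ∈ (H i).graph := by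
      intro r
      have e1 := PolyHalfPlane.mem_graph_iff.1 hgx
      have e2 := PolyHalfPlane.mem_graph_iff.1 hgy
      rw [PolyHalfPlane.mem_graph_iff, PolyHalfPlane.gap_lineMap]
      simp only [PolyHalfPlane.gap, hαβ] at *
      linear_combination (1 - r) * e1 + r * e2
    have := h.le_dist x hx' y hy' fun r hr j => by
      rw [← PolyHalfPlane.curve_frameX (hseg r)]
      refine (harc _ ?_).1 j
      rw [frameX_lineMap, ← segment_eq_uIcc]
      exact ⟨1 - r, r, sub_nonneg.2 hr.2, hr.1, by ring, by simp⟩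
    rw [abs_sub_comm, abs_of_nonneg (sub_nonneg.2 hxy)] at this
    exact le_antisymm (h.dist_le_sub hx hxy hy) this
  · right
    have hlen := h.le_eVariationOn x hx' y hy' i hgx hgy fun w hw => (harc w hw).1
    rw [abs_sub_comm, abs_of_nonneg (sub_nonneg.2 hxy)] at hlen
    have hsub : ∀ s ∈ Icc x y, s ∈ Icc 0 L := fun s hs => ⟨hx.trans hs.1, hs.2.trans hy⟩
    have main : ∀ s ∈ Icc x y, g s ∈ (H i).graph ∧
        frameX (H i).angle (g s) ∈ uIcc (frameX (H i).angle (g x)) (frameX (H i).angle (g y)) := by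
      rcases le_total (frameX (H i).angle (g x)) (frameX (H i).angle (g y)) with hle | hle
      · rw [uIcc_of_le hle] at *
        exact mem_arc_of_length_le hxy hle
          (fun s hs t ht => h.dist_le s (hsub s hs) t (hsub t ht))
          (fun s hs => h.gap_nonneg s (hsub s hs) i) (PolyHalfPlane.curve_frameX hgx).symm
          (PolyHalfPlane.curve_frameX hgy).symm
          (Polynomial.convexOn_of_derivative_nonneg (convex_Icc _ _) fun w hw => (harc w hw).2)
          hlen
      · rw [uIcc_of_ge hle] at *
        have hrev : ∀ s ∈ Icc x y, x + y - s ∈ Icc x y := fun s hs =>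
          ⟨by linarith [hs.2], by linarith [hs.1]⟩
        have := mem_arc_of_length_le (g := fun s => g (x + y - s)) hxy hle
          (fun s hs t ht => by
            have := h.dist_le _ (hsub _ (hrev s hs)) _ (hsub _ (hrev t ht))
            rwa [sub_sub_sub_cancel_left, abs_sub_comm] at this)
          (fun s hs => h.gap_nonneg _ (hsub _ (hrev s hs)) i)
          (by simpa using (PolyHalfPlane.curve_frameX hgy).symm)
          (by simpa using (PolyHalfPlane.curve_frameX hgx).symm)
          (Polynomial.convexOn_of_derivative_nonneg (convex_Icc _ _) fun w hw => (harc w hw).2)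
          hlen
        intro s hs
        simpa using this _ (hrev s hs)
    exact ⟨h0, fun s hs => ⟨(main s hs).1, (harc _ (main s hs).2).2⟩⟩

theorem exists_piece_right (h : IsTaut H g L) {t : ℝ} (ht : t ∈ Ico 0 L) :
    ∃ t' ∈ Ioc t L, IsStraightOn g t t' ∨ ∃ i, IsArcOn (H i) g t t' := by
  have htI : t ∈ Icc 0 L := Ico_subset_Icc_self ht
  have hnear : ∀ᶠ s in 𝓝[>] t, s ∈ Ioo t L := Ioo_mem_nhdsGT ht.2
  by_cases hfreq : ∃ᶠ s in 𝓝[>] t, ∃ i, (H i).gap (g s) = 0 ∧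
      0 ≤ (H i).poly.derivative.derivative.eval (frameX (H i).angle (g s))
  · obtain ⟨i, hi⟩ : ∃ i, ∃ᶠ s in 𝓝[>] t, (H i).gap (g s) = 0 ∧
        0 ≤ (H i).poly.derivative.derivative.eval (frameX (H i).angle (g s)) := by
      by_contra hcon
      simp only [not_exists, not_frequently] at hcon
      exact hfreq ((eventually_all.2 hcon).mono fun s hs ⟨i, hi⟩ => hs i hi)
    have hgt : Tendsto g (𝓝[>] t) (𝓝 (g t)) := by
      have := (h.continuousOn t htI).mono_left
        (nhdsWithin_mono t (show Ioo t L ⊆ Icc 0 L from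
          fun s hs => ⟨ht.1.trans hs.1.le, hs.2.le⟩))
      rwa [nhdsWithin_Ioo_eq_nhdsGT ht.2] at this
    set F := (H i).poly.derivative.derivative with hF
    set u : ℝ → ℝ := fun s => frameX (H i).angle (g s) with hu
    have hut : Tendsto u (𝓝[>] t) (𝓝 (u t)) :=
      ((continuous_frameX (H i).angle).tendsto _).comp hgt
    have hgapt : (H i).gap (g t) = 0 := by
      have := (((H i).continuous_gap.tendsto _).comp hgt)
      exact isClosed_singleton.mem_of_frequently_of_tendsto (hi.mono fun s hs => hs.1) this
    have hFt : 0 ≤ F.eval (u t) := by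
      have := (F.continuous.tendsto _).comp hut
      exact isClosed_Ici.mem_of_frequently_of_tendsto (hi.mono fun s hs => hs.2) this
    -- Contacts at different times have different abscissae, so they accumulate on one side of `u
    -- t`; `σ = ±1` records which.
    have hside : ∃ σ : ℝ, σ * σ = 1 ∧ ∃ᶠ s in 𝓝[>] t, ((H i).gap (g s) = 0 ∧ 0 ≤ F.eval (u s)) ∧
        0 < σ * (u s - u t) := by
      have : ∃ᶠ s in 𝓝[>] t, (((H i).gap (g s) = 0 ∧ 0 ≤ F.eval (u s)) ∧ 0 < 1 * (u s - u t)) ∨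
          (((H i).gap (g s) = 0 ∧ 0 ≤ F.eval (u s)) ∧ 0 < (-1) * (u s - u t)) := by
        refine (hi.and_eventually hnear).mono fun s ⟨hs, hsn⟩ => ?_
        have hne : u s ≠ u t := fun he => by
          have := h.injOn ⟨ht.1.trans hsn.1.le, hsn.2.le⟩ htI
            (PolyHalfPlane.eq_of_mem_graph (PolyHalfPlane.mem_graph_iff.2 hs.1)
              (PolyHalfPlane.mem_graph_iff.2 hgapt) he)
          exact absurd this hsn.1.ne'
        rcases hne.lt_or_gt with hlt | hlt
        · exact Or.inr ⟨hs, by linarith⟩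
        · exact Or.inl ⟨hs, by linarith⟩
      rcases frequently_or_distrib.1 this with h1 | h1
      · exact ⟨1, by norm_num, h1⟩
      · exact ⟨-1, by norm_num, h1⟩
    obtain ⟨σ, hσ, hside⟩ := hside
    have hr0 : Tendsto (fun s => σ * (u s - u t)) (𝓝[>] t) (𝓝 0) := by
      simpa using (hut.sub_const (u t)).const_mul σ
    have hback : ∀ s, u t + σ * (σ * (u s - u t)) = u s := by
      intro s
      linear_combination (u s - u t) * hσ
    -- The parameters `σ * (u s - u t)` of the contacts are positive and tend to `0`, so a
    -- polynomial nonnegative at all of them is nonnegative on an interval to the right of `0`.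
    have transfer : ∀ Q : Polynomial ℝ, (∀ s ∈ Ioo t L, (H i).gap (g s) = 0 →
        0 ≤ F.eval (u s) → 0 ≤ Q.eval (σ * (u s - u t))) →
        ∀ᶠ r in 𝓝[>] (0 : ℝ), 0 ≤ Q.eval r := by
      intro Q hQ
      refine Polynomial.eventually_nonneg_of_frequently fun hcon => ?_
      have := hr0.eventually (eventually_nhdsWithin_iff.1 hcon)
      obtain ⟨s, hs, h1, h2⟩ := (hside.and_eventually (hnear.and this)).exists
      exact h2 hs.2 (hQ s h1 hs.1.1 hs.1.2)
    have hgaps : ∀ j, ∀ᶠ r in 𝓝[>] (0 : ℝ), 0 ≤ (H j).gap ((H i).curve (u t + σ * r)) := by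
      intro j
      obtain ⟨Q, hQ⟩ := (H i).exists_polynomial_gap_curve (H j) (u t) σ
      have := transfer Q fun s hs h1 _ => by
        rw [hQ, hback, PolyHalfPlane.curve_frameX (PolyHalfPlane.mem_graph_iff.2 h1)]
        exact h.gap_nonneg s ⟨ht.1.trans hs.1.le, hs.2.le⟩ j
      exact this.mono fun r hr => by rwa [hQ] at hr
    have hFs : ∀ᶠ r in 𝓝[>] (0 : ℝ), 0 ≤ F.eval (u t + σ * r) := by
      have := transfer (F.comp (Polynomial.C (u t) + Polynomial.C σ * Polynomial.X))
        fun s hs _ h2 => by simpa [hback] using h2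
      exact this.mono fun r hr => by simpa using hr
    obtain ⟨δ, hδ, hball⟩ := mem_nhdsGT_iff_exists_Ioo_subset.1 ((eventually_all.2 hgaps).and hFs)
    have hδ0 : (0 : ℝ) < δ := hδ
    obtain ⟨s, hs, hsn, hsδ⟩ := (hside.and_eventually
      (hnear.and (hr0.eventually (Iio_mem_nhds hδ0)))).exists
    have hgt' := PolyHalfPlane.mem_graph_iff.2 hgapt
    refine ⟨s, ⟨hsn.1, hsn.2.le⟩, ?_⟩
    refine (h.straight_or_arc_of_arc_mem ht.1 hsn.1.le hsn.2.le hgt'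
      (PolyHalfPlane.mem_graph_iff.2 hs.1.1) fun w hw => ?_).imp_right fun h' => ⟨i, h'⟩
    have hw' : w ∈ uIcc (u t) (u s) := hw
    have hwr : ∃ r, 0 ≤ r ∧ r < δ ∧ w = u t + σ * r := by
      refine ⟨σ * (w - u t), ?_, ?_, by linear_combination (-(w - u t)) * hσ⟩
      all_goals
        rw [← segment_eq_uIcc] at hw'
        obtain ⟨a, b, ha, hb, hab, rfl⟩ := hw'
        have e : σ * (a • u t + b • u s - u t) = b * (σ * (u s - u t)) := by
          rw [smul_eq_mul, smul_eq_mul, ← eq_sub_iff_add_eq] at *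
          rw [hab]; ring
        rw [e]
      · exact mul_nonneg hb hs.2.le
      · have : σ * (u s - u t) < δ := hsδ
        nlinarith [hs.2]
    obtain ⟨r, hr, hrδ, rfl⟩ := hwr
    rcases hr.eq_or_lt with rfl | hr
    · rw [mul_zero, add_zero]
      refine ⟨fun j => ?_, hFt⟩
      rw [PolyHalfPlane.curve_frameX hgt']
      exact h.gap_nonneg t htI j
    · exact hball ⟨hr, hrδ⟩
  · rw [not_frequently] at hfreq
    obtain ⟨t', ht', hsub⟩ := mem_nhdsGT_iff_exists_Ioo_subset.1 (hfreq.and hnear)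
    have htt : t < t' := ht'
    have hlt : t < (t + t') / 2 := by linarith
    have hL : (t + t') / 2 < L := (hsub ⟨hlt, by linarith⟩).2.2
    refine ⟨(t + t') / 2, ⟨hlt, hL.le⟩, Or.inl ?_⟩
    refine h.straight_of_no_contact ht.1 hlt.le hL.le fun s hs i => ?_
    have hsI : s ∈ Ioo 0 L := ⟨lt_of_le_of_lt ht.1 hs.1, hs.2.trans hL⟩
    refine (h.gap_nonneg s (Ioo_subset_Icc_self hsI) i).lt_of_ne fun h0 => ?_
    refine h.false_of_concave_contact hsI (fun j hj => ?_) h0.symm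
    by_contra hcon
    exact (hsub ⟨hs.1, by linarith [hs.2]⟩).1 ⟨j, hj, not_lt.1 hcon⟩

theorem exists_piece_left (h : IsTaut H g L) {t : ℝ} (ht : t ∈ Ioc 0 L) :
    ∃ t' ∈ Ico 0 t, IsStraightOn g t' t ∨ ∃ i, IsArcOn (H i) g t' t := by
  obtain ⟨s, hs, hpiece⟩ := h.reverse.exists_piece_right (t := L - t)
    ⟨sub_nonneg.2 ht.2, by linarith [ht.1]⟩
  refine ⟨L - s, ⟨sub_nonneg.2 hs.2, by linarith [hs.1]⟩, hpiece.imp ?_ ?_⟩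
  · intro h'
    unfold IsStraightOn at *
    simp only [sub_sub_cancel] at h'
    rw [dist_comm, h']; ring
  · rintro ⟨i, h0, h'⟩
    refine ⟨i, h0, fun r hr => ?_⟩
    simpa using h' (L - r) ⟨by linarith [hr.2], by linarith [hr.1]⟩

end IsTaut

/-- Zeros of the second derivative do no harm: if the monotone first derivative took one value
twice, it would be constant on an interval, hence everywhere. -/
theorem Polynomial.strictConvexOn_of_derivative_nonneg {p : Polynomial ℝ} {c d : ℝ}
    (h0 : p.derivative.derivative ≠ 0)
    (h : ∀ w ∈ Icc c d, 0 ≤ p.derivative.derivative.eval w) :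
    StrictConvexOn ℝ (Icc c d) fun w => p.eval w := by
  have hmono : MonotoneOn (fun w => p.derivative.eval w) (Icc c d) := by
    refine monotoneOn_of_deriv_nonneg (convex_Icc c d) p.derivative.continuous.continuousOn
      p.derivative.differentiable.differentiableOn fun w hw => ?_
    rw [Polynomial.deriv]
    exact h w (interior_subset hw)
  have hstrict : StrictMonoOn (fun w => p.derivative.eval w) (Icc c d) := by
    intro x hx y hy hxy
    refine (hmono hx hy hxy.le).lt_of_ne fun he => h0 ?_
    have hconst : p.derivative = Polynomial.C (p.derivative.eval x) := by
      refine Polynomial.eq_of_infinite_eval_eq _ _ ((Icc_infinite hxy).mono fun w hw => ?_)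
      have hwm : w ∈ Icc c d := ⟨hx.1.trans hw.1, hw.2.trans hy.2⟩
      have h1 := hmono hx hwm hw.1
      have h2 := hmono hwm hy hw.2
      simp only at h1 h2 he
      simp only [Set.mem_ofPred_eq, Polynomial.eval_C]
      linarith
    rw [hconst, Polynomial.derivative_C]
  refine StrictMonoOn.strictConvexOn_of_deriv (convex_Icc c d) p.continuous.continuousOn ?_
  have : deriv (fun w => p.eval w) = fun w => p.derivative.eval w := by
    funext w
    simp
  rw [this]
  exact hstrict.mono interior_subset

/-! ### Assembling the finite alternating chain. -/

section AlternatingChain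

variable {k : ℕ} {H : Fin k → PolyHalfPlane} {g : ℝ → Plane} {L : ℝ}

/-- The curve `g` on `[0, y]` is an alternating sequence of straight segments, on `[s j, e j]`, and
arcs, on `[e j, s (j + 1)]`. -/
def IsAlternatingTo (H : Fin k → PolyHalfPlane) (g : ℝ → Plane) (y : ℝ) : Prop :=
  -- Sequences on all of `ℕ` can be extended by `Function.update`. `Option` supplies junk values
  -- even when `k = 0`.
  ∃ (m : ℕ) (s e : ℕ → ℝ) (i : ℕ → Option (Fin k)), s 0 = 0 ∧ e m = y ∧
    (∀ j ≤ m, 0 ≤ s j ∧ s j ≤ e j ∧ e j ≤ y ∧ IsStraightOn g (s j) (e j)) ∧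
    (∀ j < m, e j < s (j + 1) ∧ ∃ c, i j = some c ∧ IsArcOn (H c) g (e j) (s (j + 1))) ∧
    ∀ j, j + 1 < m → s (j + 1) = e (j + 1) → i j ≠ i (j + 1)

theorem isAlternatingTo_zero : IsAlternatingTo H g 0 :=
  ⟨0, fun _ => 0, fun _ => 0, fun _ => none, rfl, rfl, fun _ _ => by simp [IsStraightOn],
    fun _ hj => absurd hj (Nat.not_lt_zero _), fun _ hj => absurd hj (Nat.not_lt_zero _)⟩

/-- A chain always ends in a segment, possibly a point, so the new segment prolongs it by
`straight_trans`. -/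
theorem IsAlternatingTo.append_straight (h : IsTaut H g L) {y z : ℝ} (hy : IsAlternatingTo H g y)
    (hyz : y < z) (hz : z ≤ L) (hs : IsStraightOn g y z) : IsAlternatingTo H g z := by
  obtain ⟨m, s, e, i, h0, hm, hseg, harc, hne⟩ := hy
  have he : ∀ j < m, Function.update e m z j = e j := fun j hj => Function.update_of_ne hj.ne _ _
  refine ⟨m, s, Function.update e m z, i, h0, by simp, fun j hj => ?_, fun j hj => ?_,
    fun j hj => ?_⟩
  · obtain ⟨h1, h2, h3, h4⟩ := hseg j hj
    rcases hj.eq_or_lt with rfl | hj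
    · rw [Function.update_self]
      rw [hm] at h2 h4
      exact ⟨h1, h2.trans hyz.le, le_rfl, h.straight_trans h1 hz h2 hyz.le h4 hs⟩
    · rw [he j hj]
      exact ⟨h1, h2, h3.trans hyz.le, h4⟩
  · rw [he j hj]
    exact harc j hj
  · rw [he _ hj]
    exact hne j hj

theorem IsAlternatingTo.append_arc {y z : ℝ} (hy : IsAlternatingTo H g y)
    (hyz : y < z) {c : Fin k} (hc : IsArcOn (H c) g y z) : IsAlternatingTo H g z := by
  obtain ⟨m, s, e, i, h0, hm, hseg, harc, hne⟩ := hy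
  have hy0 : 0 ≤ y := by
    obtain ⟨h1, h2, -, -⟩ := hseg m le_rfl
    linarith
  -- If the chain ends with an arc on the same graph followed by a point, that arc is prolonged.
  -- Otherwise a new arc is added, closed by a one-point segment at `z`.
  by_cases hmerge : ∃ n, m = n + 1 ∧ s m = e m ∧ i n = some c
  · obtain ⟨n, rfl, hse, hin⟩ := hmerge
    have hs' : ∀ j < n + 1, Function.update s (n + 1) z j = s j :=
      fun j hj => Function.update_of_ne hj.ne _ _
    have he' : ∀ j < n + 1, Function.update e (n + 1) z j = e j :=
      fun j hj => Function.update_of_ne hj.ne _ _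
    refine ⟨n + 1, Function.update s (n + 1) z, Function.update e (n + 1) z, i,
      by rw [hs' 0 n.succ_pos, h0], by simp, fun j hj => ?_, fun j hj => ?_, fun j hj => ?_⟩
    · rcases hj.eq_or_lt with rfl | hj
      · simpa [IsStraightOn] using hy0.trans hyz.le
      · rw [hs' j hj, he' j hj]
        obtain ⟨h1, h2, h3, h4⟩ := hseg j hj.le
        exact ⟨h1, h2, h3.trans hyz.le, h4⟩
    · rw [he' j hj]
      obtain ⟨h1, d, hd, h2⟩ := harc j hj
      rcases (Nat.lt_succ_iff.1 hj).eq_or_lt with rfl | hj'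
      · rw [Function.update_self]
        rw [hse, hm] at h1 h2
        rw [hin] at hd
        obtain rfl : c = d := Option.some.inj hd
        exact ⟨h1.trans hyz, c, hin, h2.trans hc⟩
      · rw [hs' _ (Nat.succ_lt_succ hj')]
        exact ⟨h1, d, hd, h2⟩
    · rw [hs' _ hj, he' _ hj]
      exact hne j hj
  · have hs' : ∀ j ≤ m, Function.update s (m + 1) z j = s j :=
      fun j hj => Function.update_of_ne (by omega) _ _
    have he' : ∀ j ≤ m, Function.update e (m + 1) z j = e j :=
      fun j hj => Function.update_of_ne (by omega) _ _
    have hi' : ∀ j < m, Function.update i m (some c) j = i j :=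
      fun j hj => Function.update_of_ne hj.ne _ _
    refine ⟨m + 1, Function.update s (m + 1) z, Function.update e (m + 1) z,
      Function.update i m (some c), by rw [hs' 0 m.zero_le, h0], by simp, fun j hj => ?_,
      fun j hj => ?_, fun j hj hse => ?_⟩
    · rcases Nat.le_succ_iff.1 hj with hj | rfl
      · rw [hs' j hj, he' j hj]
        obtain ⟨h1, h2, h3, h4⟩ := hseg j hj
        exact ⟨h1, h2, h3.trans hyz.le, h4⟩
      · simpa [IsStraightOn] using hy0.trans hyz.le
    · rw [he' j (Nat.lt_succ_iff.1 hj)]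
      rcases (Nat.lt_succ_iff.1 hj).eq_or_lt with rfl | hj
      · simp only [Function.update_self, hm]
        exact ⟨hyz, c, rfl, hc⟩
      · rw [hs' _ hj, hi' j hj]
        exact harc j hj
    · have hjm : j + 1 ≤ m := Nat.lt_succ_iff.1 hj
      rw [hs' _ hjm, he' _ hjm] at hse
      rw [hi' j hjm]
      rcases hjm.eq_or_lt with rfl | hjm
      · rw [Function.update_self]
        exact fun hi => hmerge ⟨j, rfl, hse, hi⟩
      · rw [hi' _ hjm]
        exact hne j hjm hse

theorem IsTaut.isAlternatingTo (h : IsTaut H g L) (hL : 0 ≤ L) : IsAlternatingTo H g L := by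
  refine Icc_induction (R := IsAlternatingTo H g) hL isAlternatingTo_zero ?_ ?_
  · intro t ht hR
    obtain ⟨t', ht', hs | ⟨c, hc⟩⟩ := h.exists_piece_right ht
    · exact ⟨t', ht', hR.append_straight h ht'.1 ht'.2 hs⟩
    · exact ⟨t', ht', hR.append_arc ht'.1 hc⟩
  · intro t ht
    obtain ⟨t', ht', hpiece⟩ := h.exists_piece_left ht
    refine ⟨t', ht'.2, fun r hr hr' hR => ?_⟩
    rcases hpiece with hs | ⟨c, hc⟩
    · exact hR.append_straight h hr.2 ht.2 (h.straight_mono ht'.1 ht.2 hs hr'.le hr.2.le le_rfl)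
    · exact hR.append_arc hr.2 (hc.mono hr'.le le_rfl)

end AlternatingChain

/-! ### Transfer to the original parametrization. -/

namespace IsTaut

variable {k : ℕ} {H : Fin k → PolyHalfPlane} {X : Set Plane} {ℓ : ℝ → ℝ} {L : ℝ}

/-- A straight part of a taut curve `g` gives a straight piece of a monotone reparametrization. -/
theorem isStraightPiece {g γ : ℝ → Plane} (h : IsTaut H g L) {s t x y : ℝ}
    (hℓ : MonotoneOn ℓ (Icc s t)) (hst : s ≤ t) (hs : ℓ s = x) (ht : ℓ t = y)
    (hγ : ∀ τ ∈ Icc s t, γ τ = g (ℓ τ)) (hx : 0 ≤ x) (hxy : x < y) (hy : y ≤ L)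
    (hg : IsStraightOn g x y) : IsStraightPiece γ s t := by
  have hpos : 0 < y - x := sub_pos.2 hxy
  have hmem : ∀ τ ∈ Icc s t, ℓ τ ∈ Icc x y := fun τ hτ =>
    ⟨hs ▸ hℓ (left_mem_Icc.2 hst) hτ hτ.1, ht ▸ hℓ hτ (right_mem_Icc.2 hst) hτ.2⟩
  refine ⟨fun τ => (ℓ τ - x) / (y - x), fun τ hτ τ' hτ' hle => ?_, fun τ hτ => ⟨⟨?_, ?_⟩, ?_⟩⟩
  · exact div_le_div_of_nonneg_right (sub_le_sub_right (hℓ hτ hτ' hle) _) hpos.le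
  · exact div_nonneg (sub_nonneg.2 (hmem τ hτ).1) hpos.le
  · exact (div_le_one hpos).2 (sub_le_sub_right (hmem τ hτ).2 _)
  · rw [hγ τ hτ, hγ s (left_mem_Icc.2 hst), hγ t (right_mem_Icc.2 hst), hs, ht]
    exact h.eq_lineMap hx hxy hy hg (hmem τ hτ)

theorem isConvexBoundaryArc {g γ : ℝ → Plane} (h : IsTaut H g L) (hX : X = ⋂ i, (H i).carrier)
    {s t x y : ℝ} (hℓ : MonotoneOn ℓ (Icc s t)) (hst : s < t) (hs : ℓ s = x) (ht : ℓ t = y)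
    (hγ : ∀ τ ∈ Icc s t, γ τ = g (ℓ τ)) (hx : 0 ≤ x) (hxy : x < y) (hy : y ≤ L) {c : Fin k}
    (hg : IsArcOn (H c) g x y) : IsConvexBoundaryArc X (H c) γ s t := by
  have hmem : ∀ τ ∈ Icc s t, ℓ τ ∈ Icc x y := fun τ hτ =>
    ⟨hs ▸ hℓ (left_mem_Icc.2 hst.le) hτ hτ.1, ht ▸ hℓ hτ (right_mem_Icc.2 hst.le) hτ.2⟩
  have hsub : ∀ r ∈ Icc x y, r ∈ Icc 0 L := fun r hr => ⟨hx.trans hr.1, hr.2.trans hy⟩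
  have hγs : γ s = g x := by rw [hγ s (left_mem_Icc.2 hst.le), hs]
  have hγt : γ t = g y := by rw [hγ t (right_mem_Icc.2 hst.le), ht]
  have hcont : ContinuousOn (fun r => frameX (H c).angle (g r)) (Icc x y) :=
    (continuous_frameX _).comp_continuousOn (h.continuousOn.mono hsub)
  have hinj : InjOn (fun r => frameX (H c).angle (g r)) (Icc x y) := fun r hr r' hr' he =>
    h.injOn (hsub r hr) (hsub r' hr')
      (PolyHalfPlane.eq_of_mem_graph (hg.2 r hr).1 (hg.2 r' hr').1 he)
  have hgraph : ∀ τ ∈ Icc s t, γ τ ∈ (H c).graph := fun τ hτ => by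
    rw [hγ τ hτ]; exact (hg.2 _ (hmem τ hτ)).1
  refine ⟨hst, ?_, fun τ hτ => ?_, hgraph, ?_, ?_⟩
  · rw [hγs, hγt]
    exact fun he => hxy.ne (h.injOn (hsub x ⟨le_rfl, hxy.le⟩) (hsub y ⟨hxy.le, le_rfl⟩) he)
  · refine PolyHalfPlane.mem_frontier_of_mem_graph (hX ▸ iInter_subset _ c) ?_ (hgraph τ hτ)
    rw [hX, mem_iInter, hγ τ hτ]
    exact fun j => h.gap_nonneg _ (hsub _ (hmem τ hτ)) j
  -- On the graph the abscissa determines the point, so along the injective `g` it is continuous and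
  -- injective, hence monotone.
  · refine (hcont.strictMonoOn_of_injOn_Icc' hxy.le hinj).imp ?_ ?_
    · intro hm τ hτ τ' hτ' hle
      simp only [hγ τ hτ, hγ τ' hτ']
      exact hm.monotoneOn (hmem τ hτ) (hmem τ' hτ') (hℓ hτ hτ' hle)
    · intro hm τ hτ τ' hτ' hle
      simp only [hγ τ hτ, hγ τ' hτ']
      exact hm.antitoneOn (hmem τ hτ) (hmem τ' hτ') (hℓ hτ hτ' hle)
  · rw [hγs, hγt]
    refine Polynomial.strictConvexOn_of_derivative_nonneg hg.1 fun w hw => ?_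
    have hivt := intermediate_value_uIcc (a := x) (b := y) (by rwa [uIcc_of_le hxy.le])
    obtain ⟨r, hr, rfl⟩ := hivt hw
    rw [uIcc_of_le hxy.le] at hr
    exact (hg.2 r hr).2

end IsTaut

theorem isStraightPiece_self (γ : ℝ → Plane) (s : ℝ) : IsStraightPiece γ s s :=
  ⟨fun _ => 0, monotoneOn_const, fun τ hτ => by
    rw [Icc_self, mem_singleton_iff] at hτ
    simp [hτ]⟩

theorem IsShortestCurve.isAlternating {k : ℕ} {H : Fin k → PolyHalfPlane} {X : Set Plane}
    (hX : X = ⋂ i, (H i).carrier) {γ : ℝ → Plane} {a b : ℝ} {A B : Plane}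
    (h : IsShortestCurve X γ a b A B) : IsAlternating H X γ a b := by
  obtain ⟨ℓ, T, L, hL, hℓ, hℓa, hℓb, hT, hγT, hg⟩ := h.exists_isTaut hX
  set g := γ ∘ T
  have hab := h.isCurveIn.lt.le
  have hγ : ∀ t ∈ Icc a b, γ t = g (ℓ t) := fun t ht => (hγT t ht).symm
  rcases hL.eq_or_lt with rfl | hL
  · have hconst : ∀ t ∈ Icc a b, γ t = g 0 := fun t ht => by
      rw [hγ t ht]
      congr 1
      exact le_antisymm (hℓb ▸ hℓ ht (right_mem_Icc.2 hab) ht.2)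
        (hℓa ▸ hℓ (left_mem_Icc.2 hab) ht ht.1)
    refine ⟨0, fun _ => a, fun _ => b, Fin.elim0, rfl, rfl,
      fun _ => ⟨hab, fun _ => 0, monotoneOn_const, fun τ hτ => ⟨by simp, ?_⟩⟩,
      fun j => j.elim0, fun j => j.elim0⟩
    rw [hconst τ hτ, hconst a (left_mem_Icc.2 hab), AffineMap.lineMap_apply_zero]
  classical
  obtain ⟨m, s, e, i, h0, hm, hseg, harc, hne⟩ := hg.isAlternatingTo hL.le
  -- Where `ℓ` is constant at the ends, `T` may miss `a` or `b`; `τ` is a right inverse of `ℓ` on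
  -- `[0, L]` that hits both.
  let τ : ℝ → ℝ := fun x => if x = 0 then a else if x = L then b else T x
  have hτ0 : τ 0 = a := if_pos rfl
  have hτL : τ L = b := by simp [τ, hL.ne']
  have hτ : ∀ x ∈ Icc 0 L, τ x ∈ Icc a b ∧ ℓ (τ x) = x := by
    intro x hx
    by_cases hx0 : x = 0
    · subst hx0; rw [hτ0]; exact ⟨left_mem_Icc.2 hab, hℓa⟩
    by_cases hxL : x = L
    · rw [hxL, hτL]; exact ⟨right_mem_Icc.2 hab, hℓb⟩
    · simp only [τ, if_neg hx0, if_neg hxL]; exact hT x hx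
  have hτlt : ∀ x ∈ Icc 0 L, ∀ y ∈ Icc 0 L, x < y → τ x < τ y := by
    intro x hx y hy hxy
    by_contra hcon
    have := hℓ (hτ y hy).1 (hτ x hx).1 (not_lt.1 hcon)
    rw [(hτ x hx).2, (hτ y hy).2] at this
    linarith
  have hs : ∀ j ≤ m, s j ∈ Icc 0 L := fun j hj =>
    ⟨(hseg j hj).1, (hseg j hj).2.1.trans (hseg j hj).2.2.1⟩
  have he : ∀ j ≤ m, e j ∈ Icc 0 L := fun j hj =>
    ⟨(hseg j hj).1.trans (hseg j hj).2.1, (hseg j hj).2.2.1⟩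
  have hsub : ∀ x ∈ Icc 0 L, ∀ y ∈ Icc 0 L, Icc (τ x) (τ y) ⊆ Icc a b := fun x hx y hy =>
    Icc_subset_Icc (hτ x hx).1.1 (hτ y hy).1.2
  have hidx : ∀ j : Fin m, ∃ c, i j = some c ∧ IsArcOn (H c) g (e j) (s (j + 1)) := fun j =>
    (harc j j.2).2
  choose c hc hcarc using hidx
  refine ⟨m, fun j => τ (s j), fun j => τ (e j), c, by simp [h0, hτ0], by simp [hm, hτL],
    fun j => ?_, fun j => ?_, fun j j' hj hpt => ?_⟩
  · have hj : (j : ℕ) ≤ m := Nat.lt_succ_iff.1 j.2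
    rcases (hseg j hj).2.1.eq_or_lt with heq | hlt
    · simp only [heq]
      exact ⟨le_rfl, isStraightPiece_self γ _⟩
    · have hlt' := hτlt _ (hs j hj) _ (he j hj) hlt
      have hsub' := hsub _ (hs j hj) _ (he j hj)
      exact ⟨hlt'.le, hg.isStraightPiece (hℓ.mono hsub') hlt'.le (hτ _ (hs j hj)).2
        (hτ _ (he j hj)).2 (fun t ht => hγ t (hsub' ht)) (hs j hj).1 hlt (he j hj).2
        (hseg j hj).2.2.2⟩
  · have hj : (j : ℕ) < m := j.2
    have hlt := (harc j hj).1
    have hlt' := hτlt _ (he j hj.le) _ (hs (j + 1) hj) hlt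
    have hsub' := hsub _ (he j hj.le) _ (hs (j + 1) hj)
    exact hg.isConvexBoundaryArc hX (hℓ.mono hsub') hlt' (hτ _ (he j hj.le)).2
      (hτ _ (hs (j + 1) hj)).2 (fun t ht => hγ t (hsub' ht)) (he j hj.le).1 hlt
      (hs (j + 1) hj).2 (hcarc j)
  · have hjm : (j : ℕ) + 1 < m := hj ▸ j'.2
    have h1 := hs _ hjm.le
    have h2 := he _ hjm.le
    simp only [Fin.val_succ] at hpt
    rw [hγ _ (hτ _ h1).1, hγ _ (hτ _ h2).1, (hτ _ h1).2, (hτ _ h2).2] at hpt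
    have := hne j hjm (hg.injOn h1 h2 hpt)
    rw [← hj, hc j, hc j'] at this
    exact fun hcc => this (by rw [hcc])

/-! ### Algebraic description of the pieces. -/

section Algebraic

theorem IsDescribedByAlgebraicEquations.union {Γ Δ : Set Plane}
    (hΓ : IsDescribedByAlgebraicEquations Γ) (hΔ : IsDescribedByAlgebraicEquations Δ) :
    IsDescribedByAlgebraicEquations (Γ ∪ Δ) := by
  obtain ⟨N, q, θ, c, d, hq, rfl⟩ := hΓ
  obtain ⟨N', q', θ', c', d', hq', rfl⟩ := hΔ
  refine ⟨N + N', Fin.append q q', Fin.append θ θ', Fin.append c c', Fin.append d d', ?_, ?_⟩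
  · intro j
    induction j using Fin.addCases with
    | left j => simpa using hq j
    | right j => simpa using hq' j
  · ext p
    simp only [mem_union, mem_iUnion, Set.mem_ofPred_eq]
    constructor
    · rintro (⟨j, hj⟩ | ⟨j, hj⟩)
      · exact ⟨Fin.castAdd N' j, by simpa using hj⟩
      · exact ⟨Fin.natAdd N j, by simpa using hj⟩
    · rintro ⟨j, hj⟩
      induction j using Fin.addCases with
      | left j => exact Or.inl ⟨j, by simpa using hj⟩
      | right j => exact Or.inr ⟨j, by simpa using hj⟩

/-- The graph of a polynomial in a rotated frame is an algebraic curve. -/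
theorem exists_mvPolynomial_graph (θ : ℝ) (F : Polynomial ℝ) :
    ∃ q : MvPolynomial (Fin 2) ℝ, q ≠ 0 ∧
      ∀ p : Plane, MvPolynomial.eval (fun l => p l) q = frameY θ p - F.eval (frameX θ p) := by
  set q : MvPolynomial (Fin 2) ℝ :=
    (MvPolynomial.C (-Real.sin θ) * MvPolynomial.X 0 +
      MvPolynomial.C (Real.cos θ) * MvPolynomial.X 1) -
    Polynomial.eval₂ MvPolynomial.C (MvPolynomial.C (Real.cos θ) * MvPolynomial.X 0 +
      MvPolynomial.C (Real.sin θ) * MvPolynomial.X 1) F with hq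
  have heval : ∀ p : Plane, MvPolynomial.eval (fun l => p l) q =
      frameY θ p - F.eval (frameX θ p) := by
    intro p
    have hid : (MvPolynomial.eval (fun l => p l)).comp MvPolynomial.C = RingHom.id ℝ := by
      ext; simp
    rw [hq, map_sub, Polynomial.hom_eval₂, hid, Polynomial.eval₂_id]
    simp [frameX, frameY]
  refine ⟨q, fun h0 => ?_, heval⟩
  have := heval (framePoint θ 0 (F.eval 0 + 1))
  simp [h0] at this

/-- By the intermediate value theorem the image is the whole part of the graph between the end
abscissae, even if the curve backtracks. -/
theorem isDescribedByAlgebraicEquations_of_graph {γ : ℝ → Plane} {s t θ : ℝ} (hst : s ≤ t)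
    (hγ : ContinuousOn γ (Icc s t)) (F : Polynomial ℝ)
    (hF : ∀ τ ∈ Icc s t, frameY θ (γ τ) = F.eval (frameX θ (γ τ)))
    (hX : ∀ τ ∈ Icc s t, frameX θ (γ τ) ∈ uIcc (frameX θ (γ s)) (frameX θ (γ t))) :
    IsDescribedByAlgebraicEquations (γ '' Icc s t) := by
  obtain ⟨q, hq, heval⟩ := exists_mvPolynomial_graph θ F
  refine ⟨1, fun _ => q, fun _ => θ, fun _ => min (frameX θ (γ s)) (frameX θ (γ t)),
    fun _ => max (frameX θ (γ s)) (frameX θ (γ t)), fun _ => hq, ?_⟩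
  rw [iUnion_const]
  ext p
  simp only [Set.mem_ofPred_eq, heval]
  constructor
  · rintro ⟨τ, hτ, rfl⟩
    exact ⟨sub_eq_zero.2 (hF τ hτ), hX τ hτ⟩
  · rintro ⟨h1, h2⟩
    have hivt := intermediate_value_uIcc (a := s) (b := t)
      (f := fun τ => frameX θ (γ τ)) (by
        rw [uIcc_of_le hst]
        exact (continuous_frameX θ).comp_continuousOn hγ)
    obtain ⟨τ, hτ, he⟩ := hivt h2
    rw [uIcc_of_le hst] at hτ
    refine ⟨τ, hτ, frame_ext θ he ?_⟩
    rw [hF τ hτ, sub_eq_zero.1 h1]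
    exact congrArg F.eval he

/-- Turning the frame along the direction from `P` to `Q` makes every segment, even a point, part of
the graph of a constant polynomial. -/
theorem exists_angle_frameY_eq (P Q : Plane) : ∃ θ, frameY θ P = frameY θ Q := by
  let z : ℂ := ⟨Q 0 - P 0, Q 1 - P 1⟩
  refine ⟨z.arg, ?_⟩
  have h1 : ‖z‖ * Real.cos z.arg = Q 0 - P 0 := Complex.norm_mul_cos_arg z
  have h2 : ‖z‖ * Real.sin z.arg = Q 1 - P 1 := Complex.norm_mul_sin_arg z
  simp only [frameY]
  linear_combination Real.cos z.arg * h2 - Real.sin z.arg * h1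

theorem IsStraightPiece.isDescribedByAlgebraicEquations {γ : ℝ → Plane} {s t : ℝ} (hst : s ≤ t)
    (hγ : ContinuousOn γ (Icc s t)) (h : IsStraightPiece γ s t) :
    IsDescribedByAlgebraicEquations (γ '' Icc s t) := by
  obtain ⟨φ, -, hφ⟩ := h
  obtain ⟨θ, hθ⟩ := exists_angle_frameY_eq (γ s) (γ t)
  refine isDescribedByAlgebraicEquations_of_graph (θ := θ) hst hγ
    (Polynomial.C (frameY θ (γ s))) (fun τ hτ => ?_) fun τ hτ => ?_
  · rw [(hφ τ hτ).2, frameY_lineMap, ← hθ, Polynomial.eval_C]; ring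
  · obtain ⟨h1, h2⟩ := (hφ τ hτ).1
    rw [(hφ τ hτ).2, frameX_lineMap, ← segment_eq_uIcc]
    exact ⟨1 - φ τ, φ τ, sub_nonneg.2 h2, h1, by ring, rfl⟩

theorem IsConvexBoundaryArc.isDescribedByAlgebraicEquations {X : Set Plane} {H : PolyHalfPlane}
    {γ : ℝ → Plane} {s t : ℝ} (hγ : ContinuousOn γ (Icc s t))
    (h : IsConvexBoundaryArc X H γ s t) : IsDescribedByAlgebraicEquations (γ '' Icc s t) := by
  refine isDescribedByAlgebraicEquations_of_graph h.lt.le hγ H.poly h.mem_graph fun τ hτ => ?_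
  have hs := left_mem_Icc.2 h.lt.le
  have ht := right_mem_Icc.2 h.lt.le
  rcases h.monotone with hm | hm
  · exact mem_uIcc.2 (Or.inl ⟨hm hs hτ hτ.1, hm hτ ht hτ.2⟩)
  · exact mem_uIcc.2 (Or.inr ⟨hm hτ ht hτ.2, hm hs hτ hτ.1⟩)

theorem IsAlternating.isDescribedByAlgebraicEquations {k : ℕ} {H : Fin k → PolyHalfPlane}
    {X : Set Plane} {γ : ℝ → Plane} {a b : ℝ} (h : IsAlternating H X γ a b)
    (hγ : ContinuousOn γ (Icc a b)) : IsDescribedByAlgebraicEquations (γ '' Icc a b) := by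
  obtain ⟨m, s, e, i, rfl, rfl, hseg, harc, -⟩ := h
  have hle : ∀ j, e j ≤ e (Fin.last m) := by
    intro j
    induction j using Fin.reverseInduction with
    | last => exact le_rfl
    | cast j ih => exact ((harc j).lt.le.trans (hseg j.succ).1).trans ih
  have hglue : ∀ x y z : ℝ, x ≤ y → y ≤ z →
      IsDescribedByAlgebraicEquations (γ '' Icc x y) →
      IsDescribedByAlgebraicEquations (γ '' Icc y z) →
      IsDescribedByAlgebraicEquations (γ '' Icc x z) := by
    intro x y z hxy hyz h1 h2
    rw [← Icc_union_Icc_eq_Icc hxy hyz, image_union]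
    exact h1.union h2
  suffices ∀ j, s 0 ≤ e j ∧ IsDescribedByAlgebraicEquations (γ '' Icc (s 0) (e j)) from
    (this _).2
  intro j
  induction j using Fin.induction with
  | zero =>
    exact ⟨(hseg 0).1, (hseg 0).2.isDescribedByAlgebraicEquations (hseg 0).1
      (hγ.mono (Icc_subset_Icc_right (hle 0)))⟩
  | succ j ih =>
    have h1 := (harc j).lt.le
    have h2 := (hseg j.succ).1
    have h3 := hle j.succ
    refine ⟨(ih.1.trans h1).trans h2, hglue _ _ _ (ih.1.trans h1) h2
      (hglue _ _ _ ih.1 h1 ih.2 ?_) ?_⟩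
    · exact (harc j).isDescribedByAlgebraicEquations
        (hγ.mono (Icc_subset_Icc ih.1 (h2.trans h3)))
    · exact (hseg j.succ).2.isDescribedByAlgebraicEquations h2
        (hγ.mono (Icc_subset_Icc (ih.1.trans h1) h3))

end Algebraic

theorem IsPiecewiseC2.continuousOn {γ : ℝ → Plane} {a b : ℝ} (h : IsPiecewiseC2 γ a b) :
    ContinuousOn γ (Icc a b) := by
  obtain ⟨K, hK0, hK⟩ := (PiecewiseC2From.of_isPiecewiseC2 h).exists_dist_le
  have : LipschitzOnWith ⟨K, hK0⟩ γ (Icc a b) := by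
    refine LipschitzOnWith.of_dist_le_mul fun x hx y hy => ?_
    rw [Real.dist_eq]
    rcases le_total x y with hxy | hxy
    · rw [abs_sub_comm, abs_of_nonneg (sub_nonneg.2 hxy)]
      exact hK x hx y hy hxy
    · rw [dist_comm, abs_of_nonneg (sub_nonneg.2 hxy)]
      exact hK y hy x hx hxy
  exact this.continuousOn

theorem corollary3p5 {k : ℕ} (H : Fin k → PolyHalfPlane) (X : Set Plane)
    (hX : IsTypeIRegion H X) (A B : Plane) (γ : ℝ → Plane) (a b : ℝ)
    (hγ : IsShortestCurve X γ a b A B) :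
    IsAlternating H X γ a b ∧ IsDescribedByAlgebraicEquations (γ '' Set.Icc a b) := by
  have halt := hγ.isAlternating hX.eq_iInter
  exact ⟨halt, halt.isDescribedByAlgebraicEquations hγ.isCurveIn.piecewiseC2.continuousOn⟩
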